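/- A set $K\subseteq\mathbb R^N$ is called $p$-convex ($0<p<1$) if $K=-K$ and $\lambda^{1/p}x+(1-\lambda)^{1/p}y\in K$ for all $x,y\in K$ and $0<\lambda<1$; a $p$-convex body is a compact $p$-convex set with non-empty interior. Let $G$ be a standard Gaussian random variable and let $W$, independent of $G$, be uniform on the interval $\left[\sqrt{3/7},\,2\sqrt{3/7}\right]$. **Theorem.** There are universal constants $c,C>0$ such that the following holds for every integer $n\ge 1$. Let $N=n+\lceil n^{5/2}\log^2 n\rceil$. There are a $\frac12$-convex body $K\subseteq\mathbb R^N$ and a subspace $E\subseteq\mathbb R^N$ with $\dim E=n$ such that, if $X$ is distributed uniformly in $K$, then for every $\theta\in S^{N-1}\cap E$: 1. for every $t\in\mathbb R$ there is $s\in\mathbb R$ with $|s-1|\le C n^{-\frac12+\frac1{100}}$ and $$\Big|\,\mathbb P\big(|\theta\cdot \mathrm{Proj}_E X|\le t\big)-\mathbb P\big(|G|\,W\le ts\big)\Big|\le \frac{C}{\sqrt n};$$ 2. the Kolmogorov distance, the ($L^1$-)Wasserstein distance and the Lévy–Prokhorov distance between the law of $\theta\cdot \mathrm{Proj}_E X$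 and any Gaussian law $N(m,v)$, $m\in\mathbb R$, $v\ge 0$, are all at least $c$. Consequently the central limit theorem for convex bodies does not extend to $\frac12$-convex bodies: there is no sequence $\varepsilon_n\to 0$ such that for all $n\ge1$ and $M$, every $\frac12$-convex body $K\subseteq\mathbb R^M$ and every $n$-dimensional subspace $E\subseteq\mathbb R^M$ there is some $\theta\in S^{M-1}\cap E$ for which the law of $\theta\cdot\mathrm{Proj}_E X$, $X$ uniform in $K$, is within Kolmogorov distance $\varepsilon_n$ of some Gaussian law. -/

import Mathlib

open MeasureTheory ProbabilityTheory Filter Topology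
open scoped ENNReal NNReal Pointwise

/-- A set `K` in a real vector space is `p`-convex if `K = -K` and
`l ^ (1/p) x + (1 - l) ^ (1/p) y ∈ K` for all `x, y ∈ K` and `0 < l < 1`. -/
def IsPConvex {V : Type*} [AddCommGroup V] [Module ℝ V] (p : ℝ) (K : Set V) : Prop :=
  K = -K ∧ ∀ x ∈ K, ∀ y ∈ K, ∀ l : ℝ, 0 < l → l < 1 →
    l ^ (1 / p) • x + (1 - l) ^ (1 / p) • y ∈ K

/-- A `p`-convex body in `ℝ^N`: a compact `p`-convex set with non-empty interior. -/
structure IsPConvexBody {N : ℕ} (p : ℝ) (K : Set (EuclideanSpace ℝ (Fin N))) : Prop where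
  isPConvex : IsPConvex p K
  isCompact : IsCompact K
  nonempty_interior : (interior K).Nonempty

/-- The uniform probability distribution on `K`: Lebesgue measure restricted to `K`, divided by
the volume of `K`. -/
noncomputable def uniformLaw {V : Type*} [MeasureSpace V] (K : Set V) : Measure V :=
  cond volume K

/-- The law of the real random variable `θ · Proj_E X`, where `X` is uniform on `K` and `Proj_E` is
the orthogonal projection onto `E`. -/
noncomputable def marginalLaw {N : ℕ} (K : Set (EuclideanSpace ℝ (Fin N)))
    (E : Submodule ℝ (EuclideanSpace ℝ (Fin N))) (θ : EuclideanSpace ℝ (Fin N)) : Measure ℝ :=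
  (uniformLaw K).map (fun x => inner ℝ θ (E.starProjection x))

/-- The law of `|G| W`, where `G` is a standard Gaussian, `W` is uniform on the interval
`[√(3/7), 2√(3/7)]`, and `G` and `W` are independent. -/
noncomputable def absGaussianMulUniformLaw : Measure ℝ :=
  ((gaussianReal 0 1).prod (uniformLaw (Set.Icc (√(3 / 7)) (2 * √(3 / 7))))).map
    (fun q : ℝ × ℝ => |q.1| * q.2)

/-- The Kolmogorov distance of two probability measures on `ℝ`: the supremum distance of their
distribution functions. -/
noncomputable def kolmogorovDist (μ ν : Measure ℝ) : ℝ :=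
  ⨆ t : ℝ, |μ.real (Set.Iic t) - ν.real (Set.Iic t)|

/-- The (`L¹`-)Wasserstein distance of two probability measures on `ℝ`: the infimum of
`∫ |x - y| dπ(x, y)` over all couplings `π`. -/
noncomputable def wassersteinDist (μ ν : Measure ℝ) : ℝ≥0∞ :=
  ⨅ π ∈ {π : Measure (ℝ × ℝ) | π.map Prod.fst = μ ∧ π.map Prod.snd = ν},
    ∫⁻ q, edist q.1 q.2 ∂π

/-- The dimension `N = n + n^(5/2) log² n`, the second summand rounded up to an integer. -/
noncomputable def ambientDim (n : ℕ) : ℕ :=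
  n + ⌈(n : ℝ) ^ (5 / 2 : ℝ) * Real.log n ^ 2⌉₊

/-!
The fibers of the projection of a body of revolution in `ℝ ^ N` to its axis `E` are balls of
dimension `M = N - n`, so the projection of the uniform law has density proportional to the `M`-th
power of the radial profile. Taking for the profile the `M`-th root of the density of `W • Γ`,
with `Γ` a standard Gaussian vector of `E` and `W` independent of `Γ`, realizes as marginal law a
scale mixture of Gaussians, up to a truncation at radius of order `√n`. The root is so flat when
`n = o(M)` that the truncated body is `p`-convex: since `l ^ (1 / p) + (1 - l) ^ (1 / p) < 1`, a
`p`-convex combination loses more in the radius than the profile decreases on the truncated range.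

A mixture `|G| W` with non-constant `W` is not Gaussian, and compactness turns this into a positive
distance to all Gaussian laws. The finitely many small dimensions, where the truncation error is not
negligible, are covered by Euclidean balls, whose marginals are bounded and hence not Gaussian.
-/

/-- The distribution functions of `μ` and `ν` are within Lévy distance `δ` of each other. The Lévy
distance is dominated by the Kolmogorov, Wasserstein and Lévy–Prokhorov distances alike, and it
metrizes weak convergence. -/
def LevyClose (δ : ℝ) (μ ν : Measure ℝ) : Prop :=
  ∀ t, μ.real (Set.Iic t) ≤ ν.real (Set.Iic (t + δ)) + δ ∧
    ν.real (Set.Iic t) ≤ μ.real (Set.Iic (t + δ)) + δ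

namespace LevyClose

variable {δ ε : ℝ} {μ μ' ν : Measure ℝ}

lemma refl (μ : Measure ℝ) : LevyClose 0 μ μ := fun t ↦ by simp

lemma mono [IsFiniteMeasure μ] [IsFiniteMeasure ν] (h : LevyClose δ μ ν) (hδ : δ ≤ ε) :
    LevyClose ε μ ν := fun t ↦
  ⟨(h t).1.trans (add_le_add (measureReal_mono (Set.Iic_subset_Iic.2 (by linarith))) hδ),
    (h t).2.trans (add_le_add (measureReal_mono (Set.Iic_subset_Iic.2 (by linarith))) hδ)⟩

lemma of_abs_real_Iic_sub_le [IsFiniteMeasure μ'] [IsFiniteMeasure ν] (h : LevyClose δ μ ν)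
    (hμ : ∀ t, |μ.real (Set.Iic t) - μ'.real (Set.Iic t)| ≤ ε) : LevyClose (δ + ε) μ' ν := by
  have hε : 0 ≤ ε := (abs_nonneg _).trans (hμ 0)
  have hmono (ρ : Measure ℝ) [IsFiniteMeasure ρ] (t : ℝ) :
      ρ.real (Set.Iic (t + δ)) ≤ ρ.real (Set.Iic (t + (δ + ε))) :=
    measureReal_mono (Set.Iic_subset_Iic.2 (by linarith))
  intro t
  constructor
  · linarith [(h t).1, hmono ν t, (abs_le.1 (hμ t)).1]
  · linarith [(h t).2, hmono μ' t, (abs_le.1 (hμ (t + δ))).2]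

end LevyClose

lemma bddAbove_range_abs_real_sub {ι α : Type*} [MeasurableSpace α] (μ ν : Measure α)
    [IsFiniteMeasure μ] [IsFiniteMeasure ν] (A : ι → Set α) :
    BddAbove (Set.range fun i ↦ |μ.real (A i) - ν.real (A i)|) := by
  refine ⟨μ.real Set.univ + ν.real Set.univ, ?_⟩
  rintro _ ⟨i, rfl⟩
  refine (abs_sub _ _).trans ?_
  rw [abs_of_nonneg measureReal_nonneg, abs_of_nonneg measureReal_nonneg]
  exact add_le_add (measureReal_mono (Set.subset_univ _)) (measureReal_mono (Set.subset_univ _))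

lemma abs_real_Iic_sub_le_kolmogorovDist (μ ν : Measure ℝ) [IsFiniteMeasure μ] [IsFiniteMeasure ν]
    (t : ℝ) : |μ.real (Set.Iic t) - ν.real (Set.Iic t)| ≤ kolmogorovDist μ ν :=
  le_ciSup (bddAbove_range_abs_real_sub μ ν Set.Iic) t

lemma levyClose_kolmogorovDist (μ ν : Measure ℝ) [IsFiniteMeasure μ] [IsFiniteMeasure ν] :
    LevyClose (kolmogorovDist μ ν) μ ν := by
  simpa only [zero_add] using (LevyClose.refl ν).of_abs_real_Iic_sub_le (μ' := μ) fun t ↦ by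
    rw [abs_sub_comm]
    exact abs_real_Iic_sub_le_kolmogorovDist μ ν t

lemma real_le_real_add_of_le {α β : Type*} [MeasurableSpace α] [MeasurableSpace β]
    {μ : Measure α} {ν : Measure β} [IsFiniteMeasure ν] {A : Set α} {B : Set β} {δ : ℝ}
    (hδ : 0 ≤ δ) (h : μ A ≤ ν B + ENNReal.ofReal δ) : μ.real A ≤ ν.real B + δ := by
  have := ENNReal.toReal_mono (by finiteness) h
  rwa [ENNReal.toReal_add (by finiteness) (by finiteness), ENNReal.toReal_ofReal hδ] at this

lemma thickening_Iic_subset (δ t : ℝ) : Metric.thickening δ (Set.Iic t) ⊆ Set.Iic (t + δ) := by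
  intro x hx
  obtain ⟨y, hy, hxy⟩ := Metric.mem_thickening_iff.1 hx
  have := (abs_lt.1 (Real.dist_eq x y ▸ hxy)).2
  simp only [Set.mem_Iic] at hy ⊢
  linarith

lemma levyClose_of_levyProkhorovEDist_lt {δ : ℝ} (hδ : 0 ≤ δ) {μ ν : Measure ℝ}
    [IsFiniteMeasure μ] [IsFiniteMeasure ν]
    (h : levyProkhorovEDist μ ν < ENNReal.ofReal δ) : LevyClose δ μ ν := by
  intro t
  have hμν := left_measure_le_of_levyProkhorovEDist_lt h (measurableSet_Iic (a := t))
  have hνμ := right_measure_le_of_levyProkhorovEDist_lt h (measurableSet_Iic (a := t))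
  rw [ENNReal.toReal_ofReal hδ] at hμν hνμ
  exact ⟨real_le_real_add_of_le hδ (hμν.trans (by gcongr; exact thickening_Iic_subset δ t)),
    real_le_real_add_of_le hδ (hνμ.trans (by gcongr; exact thickening_Iic_subset δ t))⟩

lemma measure_map_Iic_le_of_lintegral_edist_le {Ω : Type*} [MeasurableSpace Ω] {π : Measure Ω}
    {f g : Ω → ℝ} (hf : Measurable f) (hg : Measurable g) {δ : ℝ} (hδ : 0 < δ)
    (h : ∫⁻ q, edist (f q) (g q) ∂π ≤ ENNReal.ofReal (δ ^ 2)) (t : ℝ) :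
    π.map f (Set.Iic t) ≤ π.map g (Set.Iic (t + δ)) + ENNReal.ofReal δ := by
  rw [Measure.map_apply hf measurableSet_Iic, Measure.map_apply hg measurableSet_Iic]
  have markov : π {q | ENNReal.ofReal δ ≤ edist (f q) (g q)} ≤ ENNReal.ofReal δ := by
    have := (mul_meas_ge_le_lintegral (hf.edist hg) (ENNReal.ofReal δ)).trans h
    rw [sq, ENNReal.ofReal_mul hδ.le] at this
    exact (ENNReal.mul_le_mul_iff_right (by simpa using hδ) (by simp)).1 this
  have hsub : f ⁻¹' Set.Iic t ⊆
      g ⁻¹' Set.Iic (t + δ) ∪ {q | ENNReal.ofReal δ ≤ edist (f q) (g q)} := by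
    intro q (hq : f q ≤ t)
    refine or_iff_not_imp_left.2 fun hq' ↦ ?_
    have hlt : t + δ < g q := not_le.1 hq'
    simp only [Set.mem_ofPred_eq]
    rw [edist_comm, edist_dist, Real.dist_eq]
    exact ENNReal.ofReal_le_ofReal (le_trans (by linarith) (le_abs_self _))
  exact (measure_mono hsub).trans ((measure_union_le _ _).trans (add_le_add_right markov _))

lemma levyClose_of_wassersteinDist_lt {δ : ℝ} (hδ : 0 < δ) {μ ν : Measure ℝ}
    [IsFiniteMeasure μ] [IsFiniteMeasure ν]
    (h : wassersteinDist μ ν < ENNReal.ofReal (δ ^ 2)) : LevyClose δ μ ν := by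
  obtain ⟨π, hπ⟩ := iInf_lt_iff.1 h
  obtain ⟨⟨rfl, rfl⟩, hlt⟩ := iInf_lt_iff.1 hπ
  exact fun t ↦
    ⟨real_le_real_add_of_le hδ.le
      (measure_map_Iic_le_of_lintegral_edist_le measurable_fst measurable_snd hδ hlt.le t),
    real_le_real_add_of_le hδ.le (measure_map_Iic_le_of_lintegral_edist_le measurable_snd
      measurable_fst hδ (by simpa only [edist_comm] using hlt.le) t)⟩

lemma sq_le_dist_of_not_levyClose {μ ν : Measure ℝ} [IsFiniteMeasure μ] [IsFiniteMeasure ν]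
    {c : ℝ} (hc : 0 < c) (hc1 : c ≤ 1) (h : ¬ LevyClose c μ ν) :
    c ^ 2 ≤ kolmogorovDist μ ν ∧ ENNReal.ofReal (c ^ 2) ≤ wassersteinDist μ ν ∧
      ENNReal.ofReal (c ^ 2) ≤ levyProkhorovEDist μ ν := by
  have hcc : c ^ 2 ≤ c := by nlinarith
  refine ⟨?_, ?_, ?_⟩ <;> by_contra! hlt
  · exact h ((levyClose_kolmogorovDist μ ν).mono (hlt.le.trans hcc))
  · exact h (levyClose_of_wassersteinDist_lt hc hlt)
  · exact h (levyClose_of_levyProkhorovEDist_lt hc.le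
      (hlt.trans_le (ENNReal.ofReal_le_ofReal hcc)))

lemma continuousAt_cdf_of_measure_singleton_eq_zero {μ : Measure ℝ} [IsProbabilityMeasure μ]
    {x : ℝ} (hx : μ {x} = 0) : ContinuousAt (cdf μ) x := by
  have hleft : Function.leftLim (cdf μ) x = cdf μ x := by
    have hsingle := (cdf μ).measure_singleton x
    rw [measure_cdf, hx] at hsingle
    have := ENNReal.ofReal_eq_zero.1 hsingle.symm
    exact le_antisymm ((monotone_cdf μ).leftLim_le le_rfl) (by linarith)
  rw [(monotone_cdf μ).continuousAt_iff_leftLim_eq_rightLim, hleft]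
  exact ((cdf μ).rightLim_eq x).symm

lemma tendsto_cdf_of_levyClose {ι : Type*} {l : Filter ι} {μ : Measure ℝ} [IsProbabilityMeasure μ]
    {ν : ι → Measure ℝ} [∀ i, IsProbabilityMeasure (ν i)] {δ : ι → ℝ} (hδ : Tendsto δ l (𝓝 0))
    (h : ∀ i, LevyClose (δ i) μ (ν i)) {x : ℝ} (hx : μ {x} = 0) :
    Tendsto (fun i ↦ cdf (ν i) x) l (𝓝 (cdf μ x)) := by
  simp only [LevyClose, ← cdf_eq_real] at h
  have hcont := (continuousAt_cdf_of_measure_singleton_eq_zero hx).tendsto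
  have upper : Tendsto (fun i ↦ cdf μ (x + δ i) + δ i) l (𝓝 (cdf μ x)) := by
    have : Tendsto (fun i ↦ x + δ i) l (𝓝 x) := by simpa using hδ.const_add x
    simpa using (hcont.comp this).add hδ
  have lower : Tendsto (fun i ↦ cdf μ (x - δ i) - δ i) l (𝓝 (cdf μ x)) := by
    have : Tendsto (fun i ↦ x - δ i) l (𝓝 x) := by simpa using hδ.const_sub x
    simpa using (hcont.comp this).sub hδ
  refine tendsto_of_tendsto_of_tendsto_of_le_of_le lower upper (fun i ↦ ?_) (fun i ↦ (h i x).2)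
  simpa using (h i (x - δ i)).1

lemma real_Ioc_eq_cdf_sub (μ : Measure ℝ) [IsProbabilityMeasure μ] (a b : ℝ) :
    μ.real (Set.Ioc a b) = cdf μ (max a b) - cdf μ a := by
  rw [cdf_eq_real, cdf_eq_real,
    ← measureReal_sdiff (Set.Iic_subset_Iic.2 (le_max_left a b)) measurableSet_Iic]
  congr 1
  ext y
  simp only [Set.mem_sdiff, Set.mem_Iic, Set.mem_Ioc, le_max_iff]
  grind

lemma dense_setOf_measure_singleton_eq_zero (μ : Measure ℝ) [SFinite μ] :
    Dense {x : ℝ | μ {x} = 0} := by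
  have hcount : {x : ℝ | 0 < μ {x}}.Countable := by
    simpa using Measure.countable_meas_level_set_pos (μ := μ) (g := fun x : ℝ ↦ x) measurable_id
  convert hcount.dense_compl ℝ using 1
  ext x
  simp

lemma tendsto_probabilityMeasure_of_tendsto_cdf {ι : Type*} {l : Filter ι}
    [l.IsCountablyGenerated] {μ : ProbabilityMeasure ℝ} {ν : ι → ProbabilityMeasure ℝ}
    (h : ∀ x, (μ : Measure ℝ) {x} = 0 → Tendsto (fun i ↦ cdf (ν i) x) l (𝓝 (cdf μ x))) :
    Tendsto ν l (𝓝 μ) := by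
  have hdense := dense_setOf_measure_singleton_eq_zero (μ : Measure ℝ)
  refine IsPiSystem.tendsto_probabilityMeasure_of_tendsto_of_mem
    (S := {s | ∃ a b, (μ : Measure ℝ) {a} = 0 ∧ (μ : Measure ℝ) {b} = 0 ∧ s = Set.Ioc a b})
    ?_ ?_ ?_ ?_
  · rintro _ ⟨a, b, ha, hb, rfl⟩ _ ⟨a', b', ha', hb', rfl⟩ -
    refine ⟨max a a', min b b', ?_, ?_, Set.Ioc_inter_Ioc⟩
    · rcases max_choice a a' with h | h <;> rwa [h]
    · rcases min_choice b b' with h | h <;> rwa [h]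
  · rintro _ ⟨a, b, -, -, rfl⟩
    exact measurableSet_Ioc
  · intro u hu x hx
    obtain ⟨l, r, ⟨hl, hr⟩, hlr⟩ := mem_nhds_iff_exists_Ioo_subset.1 (hu.mem_nhds hx)
    obtain ⟨a, ha, hla, hax⟩ := hdense.exists_between hl
    obtain ⟨b, hb, hxb, hbr⟩ := hdense.exists_between hr
    exact ⟨_, ⟨a, b, ha, hb, rfl⟩, Ioc_mem_nhds hax hxb,
      fun y hy ↦ hlr ⟨hla.trans hy.1, hy.2.trans_lt hbr⟩⟩
  · rintro _ ⟨a, b, ha, hb, rfl⟩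
    have hIoc (ρ : ProbabilityMeasure ℝ) :
        ((ρ (Set.Ioc a b) : ℝ≥0) : ℝ) = cdf ρ (max a b) - cdf ρ a :=
      real_Ioc_eq_cdf_sub (ρ : Measure ℝ) a b
    rw [← NNReal.tendsto_coe]
    simp only [hIoc]
    refine (h _ ?_).sub (h _ ha)
    rcases max_choice a b with h | h <;> rwa [h]

section SymmetricLaw

variable {V : Type*} [NormedAddCommGroup V] [InnerProductSpace ℝ V] [MeasurableSpace V]
  [BorelSpace V]

lemma charFun_im_eq_zero_of_isNegInvariant (μ : Measure V) [μ.IsNegInvariant] (t : V) :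
    (charFun μ t).im = 0 := by
  have hneg : charFun μ (-t) = charFun μ t := by
    conv_rhs => rw [← Measure.map_neg_eq_self μ]
    simpa only [neg_one_smul] using (charFun_map_smul (μ := μ) (-1) t).symm
  rw [charFun_neg] at hneg
  exact Complex.conj_eq_iff_im.1 hneg

lemma isNegInvariant_of_charFun_neg [CompleteSpace V] [SecondCountableTopology V] {μ : Measure V}
    [IsFiniteMeasure μ] (h : ∀ t, charFun μ (-t) = charFun μ t) : μ.IsNegInvariant := by
  have hmap : μ.map ((-1 : ℝ) • ·) = μ := Measure.ext_of_charFun <| funext fun t ↦ by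
    rw [charFun_map_smul, neg_one_smul, h t]
  simp only [neg_one_smul] at hmap
  exact ⟨hmap⟩

lemma charFun_eq_norm_of_isNegInvariant [SecondCountableTopology V] {μ : Measure V}
    [IsProbabilityMeasure μ] [μ.IsNegInvariant]
    (hne : ∀ t, charFun μ t ≠ 0) (t : V) : charFun μ t = ‖charFun μ t‖ := by
  have hreal (s : V) : charFun μ s = (charFun μ s).re :=
    Complex.ext rfl (charFun_im_eq_zero_of_isNegInvariant μ s)
  have hpos : 0 ≤ (charFun μ t).re := by
    by_contra! hneg
    have hcont : Continuous fun s ↦ (charFun μ s).re :=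
      Complex.continuous_re.comp continuous_charFun
    obtain ⟨s, hs⟩ := mem_range_of_exists_le_of_exists_ge hcont ⟨t, hneg.le⟩ ⟨0, by simp⟩
    exact hne s ((hreal s).trans (congrArg _ hs))
  rw [hreal t, Complex.norm_real, Real.norm_of_nonneg hpos]

end SymmetricLaw

lemma norm_charFun_gaussianReal (m : ℝ) (v : ℝ≥0) (t : ℝ) :
    ‖charFun (gaussianReal m v) t‖ = Real.exp (-(v * t ^ 2 / 2)) := by
  rw [charFun_gaussianReal, Complex.norm_exp]
  congr 1
  have : (v * t ^ 2 / 2 : ℂ) = ((v * t ^ 2 / 2 : ℝ) : ℂ) := by push_cast; rfl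
  rw [this, Complex.sub_re, Complex.ofReal_re]
  simp

lemma charFun_one_ne_zero_of_norm_charFun_eq_rpow {μ : Measure ℝ} [IsProbabilityMeasure μ]
    (h : ∀ t : ℝ, ‖charFun μ t‖ = ‖charFun μ 1‖ ^ (t ^ 2)) : charFun μ 1 ≠ 0 := by
  intro h0
  have hpunctured : Tendsto (fun t ↦ ‖charFun μ t‖) (𝓝[≠] 0) (𝓝 0) :=
    tendsto_const_nhds.congr' <| by
      filter_upwards [self_mem_nhdsWithin] with t (ht : t ≠ 0)
      rw [h t, h0, norm_zero, Real.zero_rpow (by positivity)]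
  have hcont : Tendsto (fun t ↦ ‖charFun μ t‖) (𝓝[≠] 0) (𝓝 ‖charFun μ 0‖) :=
    (continuous_charFun.norm.tendsto 0).mono_left nhdsWithin_le_nhds
  simpa using tendsto_nhds_unique hpunctured hcont

lemma eq_gaussianReal_of_norm_charFun_eq_rpow {μ : Measure ℝ} [IsProbabilityMeasure μ]
    [μ.IsNegInvariant] (h : ∀ t : ℝ, ‖charFun μ t‖ = ‖charFun μ 1‖ ^ (t ^ 2)) :
    ∃ v : ℝ≥0, μ = gaussianReal 0 v := by
  have hpos : 0 < ‖charFun μ 1‖ := norm_pos_iff.2 (charFun_one_ne_zero_of_norm_charFun_eq_rpow h)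
  have hne (t : ℝ) : charFun μ t ≠ 0 := norm_pos_iff.1 (h t ▸ Real.rpow_pos_of_pos hpos _)
  have hlog : 0 ≤ -2 * Real.log ‖charFun μ 1‖ := by
    linarith [Real.log_nonpos hpos.le (norm_charFun_le_one (μ := μ) 1)]
  lift -2 * Real.log ‖charFun μ 1‖ to ℝ≥0 using hlog with v hv
  refine ⟨v, Measure.ext_of_charFun (funext fun t ↦ ?_)⟩
  rw [charFun_eq_norm_of_isNegInvariant hne, h t, charFun_gaussianReal, Real.rpow_def_of_pos hpos,
    Complex.ofReal_exp]
  congr 1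
  rw [hv]
  push_cast
  ring

lemma exists_forall_not_levyClose_gaussianReal {μ : Measure ℝ} [IsProbabilityMeasure μ]
    [μ.IsNegInvariant] (hμ : ∀ v : ℝ≥0, μ ≠ gaussianReal 0 v) :
    ∃ c : ℝ, 0 < c ∧ ∀ (m : ℝ) (v : ℝ≥0), ¬ LevyClose c μ (gaussianReal m v) := by
  by_contra! hclose
  choose m v hmv using fun k : ℕ ↦ hclose (1 / ((k : ℝ) + 1)) (by positivity)
  let ν (k : ℕ) : ProbabilityMeasure ℝ := ⟨gaussianReal (m k) (v k), inferInstance⟩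
  have hlim : Tendsto ν atTop (𝓝 ⟨μ, inferInstance⟩) :=
    tendsto_probabilityMeasure_of_tendsto_cdf fun x hx ↦
      tendsto_cdf_of_levyClose tendsto_one_div_add_atTop_nhds_zero_nat hmv hx
  have hchar (t : ℝ) :
      Tendsto (fun k ↦ ‖charFun (gaussianReal (m k) (v k)) t‖) atTop (𝓝 ‖charFun μ t‖) :=
    (ProbabilityMeasure.tendsto_iff_tendsto_charFun.1 hlim t).norm
  have hpow (t : ℝ) : ‖charFun μ t‖ = ‖charFun μ 1‖ ^ (t ^ 2) := by
    refine tendsto_nhds_unique (hchar t)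
      (((hchar 1).rpow_const (p := t ^ 2) (Or.inr (sq_nonneg t))).congr fun k ↦ ?_)
    rw [norm_charFun_gaussianReal, norm_charFun_gaussianReal, ← Real.exp_mul]
    ring_nf
  obtain ⟨w, hw⟩ := eq_gaussianReal_of_norm_charFun_eq_rpow hpow
  exact hμ w hw

section GaussianMixture

variable {V : Type*} [NormedAddCommGroup V] [InnerProductSpace ℝ V] [FiniteDimensional ℝ V]
  [MeasurableSpace V] [BorelSpace V]

/-- The law of `W • Γ`, where `Γ` is a standard Gaussian vector of `V` and `W` has law `U` and is
independent of `Γ`. -/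
noncomputable def gaussianMixture (V : Type*) [NormedAddCommGroup V] [InnerProductSpace ℝ V]
    [FiniteDimensional ℝ V] [MeasurableSpace V] [BorelSpace V] (U : Measure ℝ) : Measure V :=
  ((stdGaussian V).prod U).map fun q ↦ q.2 • q.1

instance (U : Measure ℝ) [IsProbabilityMeasure U] : IsProbabilityMeasure (gaussianMixture V U) :=
  Measure.isProbabilityMeasure_map (by fun_prop)

lemma charFun_gaussianMixture (U : Measure ℝ) [IsProbabilityMeasure U] (t : V) :
    charFun (gaussianMixture V U) t = ((∫ w, Real.exp (-(w ^ 2 * ‖t‖ ^ 2 / 2)) ∂U : ℝ) : ℂ) := by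
  rw [charFun_apply, gaussianMixture, integral_map (by fun_prop) (by fun_prop), integral_prod_symm,
    ← integral_complex_ofReal]
  · congr with w
    simp_rw [real_inner_smul_left, ← real_inner_smul_right]
    rw [← charFun_apply, charFun_stdGaussian, norm_smul, ← Complex.ofReal_pow, mul_pow,
      Real.norm_eq_abs, sq_abs]
    push_cast
    ring_nf
  · exact Integrable.of_bound (by fun_prop) 1 (ae_of_all _ fun q ↦ by
      rw [Complex.norm_exp_ofReal_mul_I])

instance (U : Measure ℝ) [IsProbabilityMeasure U] : (gaussianMixture V U).IsNegInvariant :=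
  isNegInvariant_of_charFun_neg fun t ↦ by simp only [charFun_gaussianMixture, norm_neg]

lemma charFun_map_inner (μ : Measure V) (θ : V) (s : ℝ) :
    charFun (μ.map (inner ℝ θ ·)) s = charFun μ (s • θ) := by
  rw [charFun_apply_real, charFun_apply, integral_map (by fun_prop) (by fun_prop)]
  simp_rw [real_inner_smul_right, real_inner_comm, Complex.ofReal_mul]

lemma map_inner_gaussianMixture (U : Measure ℝ) [IsProbabilityMeasure U] {θ : V} (hθ : ‖θ‖ = 1) :
    (gaussianMixture V U).map (inner ℝ θ ·) = gaussianMixture ℝ U := by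
  have := Measure.isProbabilityMeasure_map (μ := gaussianMixture V U) (f := (inner ℝ θ ·))
    (by fun_prop)
  refine Measure.ext_of_charFun (funext fun s ↦ ?_)
  rw [charFun_map_inner, charFun_gaussianMixture, charFun_gaussianMixture, norm_smul, hθ, mul_one]

lemma stdGaussian_real : stdGaussian ℝ = gaussianReal 0 1 := by
  refine Measure.ext_of_charFun (funext fun s ↦ ?_)
  rw [charFun_stdGaussian, charFun_gaussianReal, Real.norm_eq_abs, ← Complex.ofReal_pow, sq_abs]
  simp [neg_div]

lemma ae_eq_integral_of_integral_sq_eq {Ω : Type*} [MeasurableSpace Ω] {P : Measure Ω}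
    [IsProbabilityMeasure P] {Z : Ω → ℝ} (hZ : MemLp Z 2 P)
    (h : ∫ ω, Z ω ^ 2 ∂P = (∫ ω, Z ω ∂P) ^ 2) : Z =ᵐ[P] fun _ ↦ ∫ ω, Z ω ∂P := by
  have hvar : variance Z P = 0 := by
    rw [variance_eq_sub hZ]
    simp only [Pi.pow_apply, h, sub_self]
  rw [← evariance_eq_zero_iff hZ.1.aemeasurable, ← hZ.ofReal_variance_eq, ENNReal.ofReal_eq_zero,
    hvar]

lemma eq_dirac_of_ae_eq {α : Type*} [MeasurableSpace α] {μ : Measure α}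
    [IsProbabilityMeasure μ] {a : α} (h : ∀ᵐ x ∂μ, x = a) : μ = .dirac a := by
  have hid : id =ᵐ[μ] fun _ ↦ a := h
  rw [← Measure.map_id (μ := μ), Measure.map_congr hid, Measure.map_const, measure_univ, one_smul]

/-- If a scale mixture were Gaussian, `exp (-W² / 2)` would have zero variance, since its first two
moments are values of the characteristic function, at `1` and `√2`. -/
lemma gaussianMixture_ne_gaussianReal {U : Measure ℝ} [IsProbabilityMeasure U]
    (hpos : ∀ᵐ w ∂U, 0 < w) (hU : ∀ w, U ≠ .dirac w) (v : ℝ≥0) :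
    gaussianMixture ℝ U ≠ gaussianReal 0 v := by
  intro heq
  have hchar (t : ℝ) :
      ∫ w, Real.exp (-(w ^ 2 * t ^ 2 / 2)) ∂U = Real.exp (-(v * t ^ 2 / 2)) := by
    have h := charFun_gaussianMixture U t
    rw [heq, charFun_gaussianReal, Real.norm_eq_abs, sq_abs] at h
    have hexp : (t * (0 : ℝ) * Complex.I - v * t ^ 2 / 2 : ℂ) = ((-(v * t ^ 2 / 2) : ℝ) : ℂ) := by
      push_cast
      ring
    rw [hexp, ← Complex.ofReal_exp] at h
    exact_mod_cast h.symm
  have hmean : ∫ w, Real.exp (-(w ^ 2 / 2)) ∂U = Real.exp (-(v / 2)) := by simpa using hchar 1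
  have hsq : ∫ w, Real.exp (-(w ^ 2 / 2)) ^ 2 ∂U = Real.exp (-(v / 2)) ^ 2 := by
    have h := hchar √2
    rw [Real.sq_sqrt zero_le_two] at h
    simp_rw [← Real.exp_nat_mul]
    convert h using 3 <;> push_cast <;> ring_nf
  have hmem : MemLp (fun w ↦ Real.exp (-(w ^ 2 / 2))) 2 U := by
    refine MemLp.of_bound (by fun_prop) 1 (ae_of_all _ fun w ↦ ?_)
    rw [Real.norm_of_nonneg (Real.exp_pos _).le, Real.exp_le_one_iff]
    linarith [sq_nonneg w]
  have hconst := ae_eq_integral_of_integral_sq_eq hmem (by rw [hsq, hmean])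
  refine hU √v (eq_dirac_of_ae_eq ?_)
  filter_upwards [hconst, hpos] with w hw hw0
  rw [hmean] at hw
  have hwv : w ^ 2 = v := by linarith [Real.exp_injective hw]
  rw [← hwv, Real.sqrt_sq hw0.le]

/-- The radial profile of the density of the Gaussian law `N(0, w² Id)` in dimension `d`. -/
noncomputable def gaussianDensity (d : ℕ) (w ρ : ℝ) : ℝ :=
  (2 * Real.pi * w ^ 2) ^ (-(d / 2) : ℝ) * Real.exp (-(1 / (2 * w ^ 2)) * ρ ^ 2)

lemma gaussianDensity_pos (d : ℕ) {w : ℝ} (hw : 0 < w) (ρ : ℝ) : 0 < gaussianDensity d w ρ := by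
  unfold gaussianDensity
  positivity

@[fun_prop]
lemma measurable_gaussianDensity (d : ℕ) :
    Measurable fun q : ℝ × ℝ ↦ gaussianDensity d q.1 q.2 := by
  unfold gaussianDensity
  fun_prop

@[fun_prop]
lemma continuous_gaussianDensity (d : ℕ) (w : ℝ) : Continuous (gaussianDensity d w) := by
  unfold gaussianDensity
  fun_prop

lemma integrable_const_mul_exp_neg_mul_sq_norm (c : ℝ) {b : ℝ} (hb : 0 < b) :
    Integrable fun x : V ↦ c * Real.exp (-b * ‖x‖ ^ 2) := by
  have h := (GaussianFourier.integrable_cexp_neg_mul_sq_norm_add (V := V) (b := (b : ℂ))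
    (by simpa using hb) 0 0).re
  refine Integrable.const_mul (h.congr (ae_of_all _ fun x ↦ ?_)) c
  simp only [zero_mul, add_zero]
  rw [← Complex.exp_ofReal_re]
  push_cast
  rfl

lemma lintegral_const_mul_exp_neg_mul_sq_norm {b c : ℝ} (hb : 0 < b) (hc : 0 ≤ c) :
    ∫⁻ x : V, ENNReal.ofReal (c * Real.exp (-b * ‖x‖ ^ 2)) =
      ENNReal.ofReal (c * (Real.pi / b) ^ (Module.finrank ℝ V / 2 : ℝ)) := by
  rw [← ofReal_integral_eq_lintegral_ofReal (integrable_const_mul_exp_neg_mul_sq_norm c hb)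
    (ae_of_all _ fun x ↦ by positivity), integral_const_mul,
    GaussianFourier.integral_rexp_neg_mul_sq_norm hb]

lemma integral_gaussianDensity_mul_cexp {w : ℝ} (hw : 0 < w) (t : V) :
    ∫ x : V, (gaussianDensity (Module.finrank ℝ V) w ‖x‖ : ℂ) *
      Complex.exp (inner ℝ x t * Complex.I) = Real.exp (-(w ^ 2 * ‖t‖ ^ 2 / 2)) := by
  set d := Module.finrank ℝ V
  have hb : 0 < ((1 / (2 * w ^ 2) : ℝ) : ℂ).re := by
    rw [Complex.ofReal_re]
    positivity
  have hintegrand (x : V) : (gaussianDensity d w ‖x‖ : ℂ) * Complex.exp (inner ℝ x t * Complex.I) =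
      (((2 * Real.pi * w ^ 2) ^ (-(d / 2) : ℝ) : ℝ) : ℂ) *
      Complex.exp (-((1 / (2 * w ^ 2) : ℝ) : ℂ) * ‖x‖ ^ 2 + Complex.I * inner ℝ t x) := by
    rw [gaussianDensity, Complex.ofReal_mul, Complex.ofReal_exp, mul_assoc, ← Complex.exp_add,
      real_inner_comm]
    push_cast
    ring_nf
  have hconst : (Real.pi / ((1 / (2 * w ^ 2) : ℝ) : ℂ)) ^ (d / 2 : ℂ) =
      (((2 * Real.pi * w ^ 2) ^ (d / 2 : ℝ) : ℝ) : ℂ) := by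
    rw [Complex.ofReal_cpow (by positivity), ← Complex.ofReal_div,
      show Real.pi / (1 / (2 * w ^ 2)) = 2 * Real.pi * w ^ 2 by field_simp]
    push_cast
    rfl
  have hw' : (w : ℂ) ≠ 0 := by exact_mod_cast hw.ne'
  simp_rw [hintegrand]
  rw [integral_const_mul, GaussianFourier.integral_cexp_neg_mul_sq_norm_add hb, hconst,
    ← mul_assoc, ← Complex.ofReal_mul, ← Real.rpow_add (by positivity), neg_add_cancel,
    Real.rpow_zero, Complex.ofReal_one, one_mul, Complex.I_sq, Complex.ofReal_exp]
  congr 1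
  push_cast
  field_simp
  ring

lemma integrable_gaussianDensity_norm (d : ℕ) {w : ℝ} (hw : 0 < w) :
    Integrable fun x : V ↦ gaussianDensity d w ‖x‖ :=
  integrable_const_mul_exp_neg_mul_sq_norm _ (by positivity)

lemma map_smul_stdGaussian_eq_withDensity {w : ℝ} (hw : 0 < w) :
    (stdGaussian V).map (w • ·) = volume.withDensity fun x ↦
      ENNReal.ofReal (gaussianDensity (Module.finrank ℝ V) w ‖x‖) := by
  have := Measure.isProbabilityMeasure_map (μ := stdGaussian V) (f := (w • ·)) (by fun_prop)
  have := (integrable_gaussianDensity_norm (V := V) (Module.finrank ℝ V) hw).hasFiniteIntegral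
  have := isFiniteMeasure_withDensity_ofReal this
  refine Measure.ext_of_charFun (funext fun t ↦ ?_)
  rw [charFun_map_smul, charFun_stdGaussian, charFun_apply,
    integral_withDensity_eq_integral_toReal_smul (by fun_prop)
      (ae_of_all _ fun x ↦ ENNReal.ofReal_lt_top)]
  simp_rw [ENNReal.toReal_ofReal (gaussianDensity_pos _ hw _).le, Complex.real_smul]
  rw [integral_gaussianDensity_mul_cexp hw, norm_smul, Real.norm_of_nonneg hw.le]
  push_cast
  ring_nf

lemma lintegral_exp_sq_norm_div_four_stdGaussian :
    ∫⁻ x, ENNReal.ofReal (Real.exp (‖x‖ ^ 2 / 4)) ∂(stdGaussian V) =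
      ENNReal.ofReal (2 ^ (Module.finrank ℝ V / 2 : ℝ)) := by
  have hdens : stdGaussian V = volume.withDensity fun x ↦
      ENNReal.ofReal (gaussianDensity (Module.finrank ℝ V) 1 ‖x‖) := by
    rw [← map_smul_stdGaussian_eq_withDensity one_pos]
    simp
  have hintegrand (x : V) : ENNReal.ofReal (gaussianDensity (Module.finrank ℝ V) 1 ‖x‖) *
      ENNReal.ofReal (Real.exp (‖x‖ ^ 2 / 4)) = ENNReal.ofReal
        ((2 * Real.pi) ^ (-(Module.finrank ℝ V / 2) : ℝ) * Real.exp (-(1 / 4) * ‖x‖ ^ 2)) := by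
    rw [← ENNReal.ofReal_mul (gaussianDensity_pos _ one_pos _).le, gaussianDensity, mul_assoc,
      ← Real.exp_add]
    ring_nf
  rw [hdens, lintegral_withDensity_eq_lintegral_mul _ (by fun_prop) (by fun_prop)]
  simp only [Pi.mul_apply, hintegrand]
  rw [lintegral_const_mul_exp_neg_mul_sq_norm (by norm_num) (by positivity),
    show Real.pi / (1 / 4) = 2 * (2 * Real.pi) by ring, Real.mul_rpow (y := 2 * Real.pi) zero_le_two
    (by positivity), Real.rpow_neg (by positivity)]
  field_simp

lemma stdGaussian_sq_norm_gt_le :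
    stdGaussian V {x | 8 * (Module.finrank ℝ V : ℝ) < ‖x‖ ^ 2} ≤
      ENNReal.ofReal (Real.exp (-(Module.finrank ℝ V : ℝ))) := by
  set d : ℝ := (Module.finrank ℝ V : ℝ)
  have hd : 0 ≤ d := Nat.cast_nonneg _
  have hsub : {x : V | 8 * d < ‖x‖ ^ 2} ⊆
      {x | ENNReal.ofReal (Real.exp (2 * d)) ≤ ENNReal.ofReal (Real.exp (‖x‖ ^ 2 / 4))} :=
    fun x (hx : 8 * d < ‖x‖ ^ 2) ↦ ENNReal.ofReal_le_ofReal (Real.exp_le_exp.2 (by linarith))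
  have hpow : (2 : ℝ) ^ (d / 2) ≤ Real.exp d := by
    rw [← Real.exp_one_rpow d]
    have : (2 : ℝ) ≤ Real.exp 1 := by linarith [Real.add_one_le_exp (1 : ℝ)]
    exact (Real.rpow_le_rpow_of_exponent_le one_le_two (by linarith)).trans
      (Real.rpow_le_rpow zero_le_two this hd)
  calc stdGaussian V {x | 8 * d < ‖x‖ ^ 2}
      ≤ (∫⁻ x, ENNReal.ofReal (Real.exp (‖x‖ ^ 2 / 4)) ∂(stdGaussian V)) /
          ENNReal.ofReal (Real.exp (2 * d)) :=
        (measure_mono hsub).trans (meas_ge_le_lintegral_div (by fun_prop)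
          (by simpa using Real.exp_pos _) ENNReal.ofReal_ne_top)
    _ = ENNReal.ofReal (2 ^ (d / 2) / Real.exp (2 * d)) := by
        rw [lintegral_exp_sq_norm_div_four_stdGaussian, ENNReal.ofReal_div_of_pos (Real.exp_pos _)]
    _ ≤ ENNReal.ofReal (Real.exp d / Real.exp (2 * d)) := by gcongr
    _ = ENNReal.ofReal (Real.exp (-d)) := by
        rw [← Real.exp_sub]
        ring_nf

lemma gaussianMixture_norm_gt_le {U : Measure ℝ} [IsProbabilityMeasure U] {b R : ℝ}
    (hU : ∀ᵐ w ∂U, |w| ≤ b) (hR : 0 ≤ R) (hbR : 8 * b ^ 2 * Module.finrank ℝ V ≤ R ^ 2) :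
    gaussianMixture V U {x | R < ‖x‖} ≤ ENNReal.ofReal (Real.exp (-(Module.finrank ℝ V : ℝ))) := by
  have hmeas : MeasurableSet {x : V | R < ‖x‖} := measurableSet_lt (by fun_prop) (by fun_prop)
  rw [gaussianMixture, Measure.map_apply (by fun_prop) hmeas]
  have hscale : ∀ᵐ q ∂((stdGaussian V).prod U), |q.2| ≤ b :=
    Measure.quasiMeasurePreserving_snd.ae hU
  calc (stdGaussian V).prod U ((fun q ↦ q.2 • q.1) ⁻¹' {x | R < ‖x‖})
      ≤ (stdGaussian V).prod U
          (Prod.fst ⁻¹' {x | 8 * (Module.finrank ℝ V : ℝ) < ‖x‖ ^ 2}) := by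
        refine measure_mono_ae ?_
        filter_upwards [hscale] with q hq (hlt : R < ‖q.2 • q.1‖)
        change 8 * (Module.finrank ℝ V : ℝ) < ‖q.1‖ ^ 2
        have hsq : R ^ 2 < b ^ 2 * ‖q.1‖ ^ 2 := by
          rw [← mul_pow]
          rw [norm_smul, Real.norm_eq_abs] at hlt
          exact pow_lt_pow_left₀ (hlt.trans_le (by gcongr)) hR two_ne_zero
        nlinarith [sq_nonneg b]
    _ = stdGaussian V {x | 8 * (Module.finrank ℝ V : ℝ) < ‖x‖ ^ 2} :=
        measurePreserving_fst.measure_preimage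
          (measurableSet_lt (by fun_prop) (by fun_prop)).nullMeasurableSet
    _ ≤ _ := stdGaussian_sq_norm_gt_le

end GaussianMixture

/-- `f` is a positive profile on `[0, ∞)` which is nonincreasing, but decays no faster than the
Gaussian profile of variance `v`. Both properties survive averaging, and taking the `s`-th root
multiplies the variance by `s`. -/
structure SlowDecay (v : ℝ) (f : ℝ → ℝ) : Prop where
  pos : ∀ ρ, 0 < f ρ
  antitoneOn : AntitoneOn f (Set.Ici 0)
  monotoneOn_mul_exp : MonotoneOn (fun ρ ↦ f ρ * Real.exp (ρ ^ 2 / (2 * v))) (Set.Ici 0)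

lemma SlowDecay.rpow_inv {v : ℝ} {f : ℝ → ℝ} (hf : SlowDecay v f) {s : ℝ} (hs : 0 < s) :
    SlowDecay (s * v) fun ρ ↦ f ρ ^ s⁻¹ where
  pos ρ := Real.rpow_pos_of_pos (hf.pos ρ) _
  antitoneOn ρ hρ σ hσ h :=
    Real.rpow_le_rpow (hf.pos σ).le (hf.antitoneOn hρ hσ h) (inv_nonneg.2 hs.le)
  monotoneOn_mul_exp := by
    have hrpow (ρ : ℝ) : f ρ ^ s⁻¹ * Real.exp (ρ ^ 2 / (2 * (s * v))) =
        (f ρ * Real.exp (ρ ^ 2 / (2 * v))) ^ s⁻¹ := by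
      rw [Real.mul_rpow (hf.pos ρ).le (Real.exp_pos _).le, ← Real.exp_mul]
      congr 2
      field_simp
    simp only [hrpow]
    intro ρ hρ σ hσ h
    have := hf.pos ρ
    exact Real.rpow_le_rpow (by positivity) (hf.monotoneOn_mul_exp hρ hσ h) (inv_nonneg.2 hs.le)

lemma SlowDecay.mul_one_sub_le {v : ℝ} {f : ℝ → ℝ} (hf : SlowDecay v f) {ρ σ : ℝ}
    (hρ : 0 ≤ ρ) (h : ρ ≤ σ) : f ρ * (1 - (σ ^ 2 - ρ ^ 2) / (2 * v)) ≤ f σ := by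
  have hmono := hf.monotoneOn_mul_exp hρ (hρ.trans h) h
  calc f ρ * (1 - (σ ^ 2 - ρ ^ 2) / (2 * v))
      ≤ f ρ * Real.exp (-((σ ^ 2 - ρ ^ 2) / (2 * v))) :=
        mul_le_mul_of_nonneg_left (Real.one_sub_le_exp_neg _) (hf.pos ρ).le
    _ = f ρ * Real.exp (ρ ^ 2 / (2 * v)) * Real.exp (-(σ ^ 2 / (2 * v))) := by
        rw [mul_assoc, ← Real.exp_add]
        ring_nf
    _ ≤ f σ * Real.exp (σ ^ 2 / (2 * v)) * Real.exp (-(σ ^ 2 / (2 * v))) := by gcongr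
    _ = f σ := by rw [mul_assoc, ← Real.exp_add, add_neg_cancel, Real.exp_zero, mul_one]

lemma slowDecay_gaussianDensity (d : ℕ) {a w : ℝ} (ha : 0 < a) (hw : a ≤ w) :
    SlowDecay (a ^ 2) (gaussianDensity d w) where
  pos := gaussianDensity_pos d (ha.trans_le hw)
  antitoneOn ρ (hρ : 0 ≤ ρ) σ _ h := by
    have : 0 ≤ 1 / (2 * w ^ 2) := by positivity
    unfold gaussianDensity
    gcongr ?_ * Real.exp ?_
    nlinarith [pow_le_pow_left₀ hρ h 2]
  monotoneOn_mul_exp ρ (hρ : 0 ≤ ρ) σ _ h := by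
    have hrate : 0 ≤ 1 / (2 * a ^ 2) - 1 / (2 * w ^ 2) := sub_nonneg.2 (by gcongr)
    simp only [gaussianDensity, mul_assoc, ← Real.exp_add]
    gcongr ?_ * Real.exp ?_
    linear_combination mul_le_mul_of_nonneg_left (pow_le_pow_left₀ hρ h 2) hrate

/-- The radial profile of the density of the scale mixture `gaussianMixture V U` in dimension
`d`. -/
noncomputable def mixtureDensity (U : Measure ℝ) (d : ℕ) (ρ : ℝ) : ℝ :=
  ∫ w, gaussianDensity d w ρ ∂U

section MixtureDensity

variable {V : Type*} [NormedAddCommGroup V] [InnerProductSpace ℝ V] [FiniteDimensional ℝ V]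
  [MeasurableSpace V] [BorelSpace V] {U : Measure ℝ} {a : ℝ}

lemma gaussianDensity_le (d : ℕ) {w : ℝ} (ha : 0 < a) (hw : a ≤ w) (ρ : ℝ) :
    gaussianDensity d w ρ ≤ (2 * Real.pi * a ^ 2) ^ (-(d / 2) : ℝ) := by
  have hexp : Real.exp (-(1 / (2 * w ^ 2)) * ρ ^ 2) ≤ 1 := by
    rw [Real.exp_le_one_iff, neg_mul, neg_nonpos]
    positivity
  have hd : (-(d / 2) : ℝ) ≤ 0 := by
    rw [neg_nonpos]
    positivity
  exact (mul_le_of_le_one_right (by positivity) hexp).trans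
    (Real.rpow_le_rpow_of_nonpos (by positivity) (by gcongr) hd)

lemma ae_norm_gaussianDensity_le (ha : 0 < a) (hU : ∀ᵐ w ∂U, a ≤ w) (d : ℕ) (ρ : ℝ) :
    ∀ᵐ w ∂U, ‖gaussianDensity d w ρ‖ ≤ (2 * Real.pi * a ^ 2) ^ (-(d / 2) : ℝ) := by
  filter_upwards [hU] with w hw
  rw [Real.norm_of_nonneg (gaussianDensity_pos d (ha.trans_le hw) ρ).le]
  exact gaussianDensity_le d ha hw ρ

variable [IsProbabilityMeasure U]

lemma integrable_gaussianDensity (ha : 0 < a) (hU : ∀ᵐ w ∂U, a ≤ w) (d : ℕ) (ρ : ℝ) :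
    Integrable (fun w ↦ gaussianDensity d w ρ) U :=
  .of_bound (by fun_prop) _ (ae_norm_gaussianDensity_le ha hU d ρ)

lemma continuous_mixtureDensity (ha : 0 < a) (hU : ∀ᵐ w ∂U, a ≤ w) (d : ℕ) :
    Continuous (mixtureDensity U d) :=
  continuous_of_dominated (fun ρ ↦ (integrable_gaussianDensity ha hU d ρ).aestronglyMeasurable)
    (ae_norm_gaussianDensity_le ha hU d) (integrable_const _) (ae_of_all _ fun w ↦ by fun_prop)

lemma integral_pos_of_ae_pos {Ω : Type*} [MeasurableSpace Ω] {P : Measure Ω} [NeZero P] {f : Ω → ℝ}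
    (hf : Integrable f P) (hpos : ∀ᵐ ω ∂P, 0 < f ω) : 0 < ∫ ω, f ω ∂P := by
  rw [integral_pos_iff_support_of_nonneg_ae (hpos.mono fun _ ↦ le_of_lt) hf, pos_iff_ne_zero]
  intro hzero
  obtain ⟨ω, hω, hω0⟩ := ((measure_eq_zero_iff_ae_notMem.1 hzero).and hpos).exists
  exact hω hω0.ne'

lemma slowDecay_mixtureDensity (ha : 0 < a) (hU : ∀ᵐ w ∂U, a ≤ w) (d : ℕ) :
    SlowDecay (a ^ 2) (mixtureDensity U d) where
  pos ρ := by
    refine integral_pos_of_ae_pos (integrable_gaussianDensity ha hU d ρ) ?_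
    filter_upwards [hU] with w hw using gaussianDensity_pos d (ha.trans_le hw) ρ
  antitoneOn ρ hρ σ hσ h := by
    refine integral_mono_ae (integrable_gaussianDensity ha hU d σ)
      (integrable_gaussianDensity ha hU d ρ) ?_
    filter_upwards [hU] with w hw
    exact (slowDecay_gaussianDensity d ha hw).antitoneOn hρ hσ h
  monotoneOn_mul_exp ρ hρ σ hσ h := by
    simp only [mixtureDensity, ← integral_mul_const]
    refine integral_mono_ae ((integrable_gaussianDensity ha hU d ρ).mul_const _)
      ((integrable_gaussianDensity ha hU d σ).mul_const _) ?_
    filter_upwards [hU] with w hw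
    exact (slowDecay_gaussianDensity d ha hw).monotoneOn_mul_exp hρ hσ h

lemma gaussianMixture_eq_withDensity (ha : 0 < a) (hU : ∀ᵐ w ∂U, a ≤ w) :
    gaussianMixture V U = volume.withDensity fun x ↦
      ENNReal.ofReal (mixtureDensity U (Module.finrank ℝ V) ‖x‖) := by
  have hpos : ∀ᵐ w ∂U, 0 < w := hU.mono fun w ↦ ha.trans_le
  ext A hA
  rw [gaussianMixture, Measure.map_apply (by fun_prop) hA,
    Measure.prod_apply_symm (measurableSet_preimage (by fun_prop) hA), withDensity_apply _ hA]
  calc ∫⁻ w, stdGaussian V ((w • ·) ⁻¹' A) ∂U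
      = ∫⁻ w, (∫⁻ x in A, ENNReal.ofReal (gaussianDensity (Module.finrank ℝ V) w ‖x‖)) ∂U := by
        refine lintegral_congr_ae ?_
        filter_upwards [hpos] with w hw
        rw [← Measure.map_apply (by fun_prop) hA, map_smul_stdGaussian_eq_withDensity hw,
          withDensity_apply _ hA]
    _ = ∫⁻ x in A, (∫⁻ w, ENNReal.ofReal (gaussianDensity (Module.finrank ℝ V) w ‖x‖) ∂U) :=
        lintegral_lintegral_swap <| Measurable.aemeasurable <| ENNReal.measurable_ofReal.comp <|
          (measurable_gaussianDensity _).comp (measurable_fst.prodMk measurable_snd.norm)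
    _ = ∫⁻ x in A, ENNReal.ofReal (mixtureDensity U (Module.finrank ℝ V) ‖x‖) := by
        congr with x
        refine (ofReal_integral_eq_lintegral_ofReal (integrable_gaussianDensity ha hU _ _) ?_).symm
        filter_upwards [hpos] with w hw using (gaussianDensity_pos _ hw _).le

end MixtureDensity

/-- The gap `1 - 2 ^ (1 - 1 / p)` between the two sides of `l ^ (1 / p) + (1 - l) ^ (1 / p) ≤ 1` at
`l = 1 / 2`; it measures how far `p`-convexity is from convexity. -/
noncomputable def convexityDefect (p : ℝ) : ℝ := 1 - 2 ^ (1 - 1 / p)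

lemma convexityDefect_pos {p : ℝ} (hp : 0 < p) (hp1 : p < 1) : 0 < convexityDefect p :=
  sub_pos.2 (Real.rpow_lt_one_of_one_lt_of_neg one_lt_two (sub_neg.2 (one_lt_one_div hp hp1)))

lemma convexityDefect_le_one (p : ℝ) : convexityDefect p ≤ 1 :=
  sub_le_self _ (by positivity)

lemma one_sub_rpow_add_rpow_le {p ε : ℝ} (hp : 0 < p) (hp1 : p ≤ 1) (hε : 0 ≤ ε)
    (hε2 : ε ≤ 1 / 2) :
    (1 - ε) ^ (1 / p) + ε ^ (1 / p) ≤ 1 - 2 * convexityDefect p * ε := by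
  have hq : 1 ≤ 1 / p := (one_le_div hp).2 hp1
  have hconv := (convexOn_rpow hq).2
  have hhalf : (1 / 2 : ℝ) ∈ Set.Ici 0 := by simp
  have hleft := hconv (Set.self_mem_Ici (a := (0 : ℝ))) hhalf (a := 1 - 2 * ε) (b := 2 * ε)
    (by linarith) (by linarith) (by ring)
  have hright := hconv (zero_le_one' ℝ) hhalf (a := 1 - 2 * ε) (b := 2 * ε)
    (by linarith) (by linarith) (by ring)
  have hval : convexityDefect p = 1 - 2 * (1 / 2) ^ (1 / p) := by
    rw [convexityDefect, Real.rpow_sub two_pos, Real.rpow_one,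
      Real.div_rpow zero_le_one zero_le_two, Real.one_rpow]
    ring
  simp only [smul_eq_mul, Real.zero_rpow (one_pos.trans_le hq).ne', Real.one_rpow, mul_zero,
    zero_add, mul_one] at hleft hright
  ring_nf at hleft hright hval ⊢
  rw [hval]
  linarith

lemma SlowDecay.le_one_add_mul {v : ℝ} {f : ℝ → ℝ} (hf : SlowDecay v f) {κ R ρ ρ' : ℝ}
    (hv : 0 < v) (hκ : κ ≤ 1) (hR : R ^ 2 ≤ κ * v) (hρ : ρ ∈ Set.Icc 0 R) (hρ' : 0 ≤ ρ') :
    f ρ' ≤ (1 + κ) * f ρ := by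
  have hκ0 : 0 ≤ κ := nonneg_of_mul_nonneg_left ((sq_nonneg R).trans hR) hv
  have hρκ : (ρ ^ 2 - 0 ^ 2) / (2 * v) ≤ κ / 2 := by
    rw [div_le_iff₀ (by positivity)]
    nlinarith [pow_le_pow_left₀ hρ.1 hρ.2 2]
  have hzero : f 0 * (1 - κ / 2) ≤ f ρ :=
    (mul_le_mul_of_nonneg_left (by linarith) (hf.pos 0).le).trans (hf.mul_one_sub_le le_rfl hρ.1)
  calc f ρ' ≤ f 0 := hf.antitoneOn Set.self_mem_Ici hρ' hρ'
    _ ≤ f 0 * ((1 + κ) * (1 - κ / 2)) := le_mul_of_one_le_right (hf.pos 0).le (by nlinarith)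
    _ = (1 + κ) * (f 0 * (1 - κ / 2)) := by ring
    _ ≤ (1 + κ) * f ρ := by gcongr

lemma SlowDecay.mul_one_sub_mul_le {v : ℝ} {f : ℝ → ℝ} (hf : SlowDecay v f) {κ R ρ σ ε : ℝ}
    (hv : 0 < v) (hR : R ^ 2 ≤ κ * v) (hρ : ρ ∈ Set.Icc 0 R) (hσ : σ ∈ Set.Icc 0 R) (hε : 0 ≤ ε)
    (hρσ : σ ≤ ρ + ε * R) : f ρ * (1 - κ * ε) ≤ f σ := by
  have hκ0 : 0 ≤ κ := nonneg_of_mul_nonneg_left ((sq_nonneg R).trans hR) hv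
  rcases le_total σ ρ with hle | hle
  · have : 1 - κ * ε ≤ 1 := sub_le_self _ (by positivity)
    exact (mul_le_of_le_one_right (hf.pos ρ).le this).trans (hf.antitoneOn hσ.1 hρ.1 hle)
  · have hdrop : (σ ^ 2 - ρ ^ 2) / (2 * v) ≤ κ * ε := by
      rw [div_le_iff₀ (by positivity)]
      calc σ ^ 2 - ρ ^ 2 = (σ - ρ) * (σ + ρ) := by ring
        _ ≤ (ε * R) * (R + R) :=
          mul_le_mul (by linarith) (add_le_add hσ.2 hρ.2) (add_nonneg hσ.1 hρ.1)
            (mul_nonneg hε (hρ.1.trans hρ.2))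
        _ ≤ κ * ε * (2 * v) := by nlinarith
    exact (mul_le_mul_of_nonneg_left (by linarith) (hf.pos ρ).le).trans
      (hf.mul_one_sub_le hρ.1 hle)

lemma SlowDecay.rpow_mul_add_le_of_le_half {v : ℝ} {f : ℝ → ℝ} (hf : SlowDecay v f)
    {p R ρ ρ' ε : ℝ} (hp : 0 < p) (hp1 : p ≤ 1) (hv : 0 < v) (hR : R ^ 2 ≤ convexityDefect p * v)
    (hρ : ρ ∈ Set.Icc 0 R) (hρ' : ρ' ∈ Set.Icc 0 R) (hε : 0 ≤ ε) (hε2 : ε ≤ 1 / 2) :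
    (1 - ε) ^ (1 / p) * f ρ + ε ^ (1 / p) * f ρ' ≤
      f ((1 - ε) ^ (1 / p) * ρ + ε ^ (1 / p) * ρ') := by
  have hsum := one_sub_rpow_add_rpow_le hp hp1 hε hε2
  have hα1 : (1 - ε) ^ (1 / p) ≤ 1 := Real.rpow_le_one (by linarith) (by linarith) (by positivity)
  have hβε : ε ^ (1 / p) ≤ ε :=
    Real.rpow_le_self_of_le_one hε (by linarith) ((one_le_div hp).2 hp1)
  have hα : 0 ≤ (1 - ε) ^ (1 / p) := Real.rpow_nonneg (by linarith) _
  have hβ : 0 ≤ ε ^ (1 / p) := Real.rpow_nonneg hε _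
  have hκ1 := convexityDefect_le_one p
  have hκ0 : 0 ≤ convexityDefect p := nonneg_of_mul_nonneg_left ((sq_nonneg R).trans hR) hv
  set κ := convexityDefect p
  set α := (1 - ε) ^ (1 / p)
  set β := ε ^ (1 / p)
  have hfρ' : f ρ' ≤ (1 + κ) * f ρ := hf.le_one_add_mul hv hκ1 hR hρ hρ'.1
  have hσρ : α * ρ + β * ρ' ≤ ρ + ε * R :=
    add_le_add (mul_le_of_le_one_left hρ.1 hα1) (mul_le_mul hβε hρ'.2 hρ'.1 hε)
  have hσ : α * ρ + β * ρ' ∈ Set.Icc 0 R := by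
    refine ⟨add_nonneg (mul_nonneg hα hρ.1) (mul_nonneg hβ hρ'.1), ?_⟩
    have hαβ : α + β ≤ 1 := by nlinarith
    nlinarith [mul_le_mul_of_nonneg_left hρ.2 hα, mul_le_mul_of_nonneg_left hρ'.2 hβ,
      hρ.1.trans hρ.2]
  have hcoeff : α + β * (1 + κ) ≤ 1 - κ * ε := by nlinarith
  calc α * f ρ + β * f ρ' ≤ f ρ * (α + β * (1 + κ)) := by
        linarith [mul_le_mul_of_nonneg_left hfρ' hβ]
    _ ≤ f ρ * (1 - κ * ε) := mul_le_mul_of_nonneg_left hcoeff (hf.pos ρ).le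
    _ ≤ f (α * ρ + β * ρ') := hf.mul_one_sub_mul_le hv hR hρ hσ hε hσρ

lemma SlowDecay.rpow_mul_add_le {v : ℝ} {f : ℝ → ℝ} (hf : SlowDecay v f) {p R ρ ρ' l : ℝ}
    (hp : 0 < p) (hp1 : p ≤ 1) (hv : 0 < v) (hR : R ^ 2 ≤ convexityDefect p * v)
    (hρ : ρ ∈ Set.Icc 0 R) (hρ' : ρ' ∈ Set.Icc 0 R) (hl : l ∈ Set.Icc 0 1) :
    l ^ (1 / p) * f ρ + (1 - l) ^ (1 / p) * f ρ' ≤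
      f (l ^ (1 / p) * ρ + (1 - l) ^ (1 / p) * ρ') := by
  rcases le_total l (1 / 2) with h | h
  · simpa only [add_comm] using hf.rpow_mul_add_le_of_le_half hp hp1 hv hR hρ' hρ hl.1 h
  · simpa only [sub_sub_cancel] using
      hf.rpow_mul_add_le_of_le_half hp hp1 hv hR hρ hρ' (sub_nonneg.2 hl.2) (ε := 1 - l)
        (by linarith)

lemma uniformLaw_map_linearIsometryEquiv {V : Type*} [NormedAddCommGroup V]
    [InnerProductSpace ℝ V] [FiniteDimensional ℝ V] [MeasurableSpace V] [BorelSpace V] {K : Set V}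
    (T : V ≃ₗᵢ[ℝ] V) (hT : T ⁻¹' K = K) : (uniformLaw K).map T = uniformLaw K := by
  have hmap := (T.measurePreserving.restrict_preimage_emb
    T.toMeasurableEquiv.measurableEmbedding K).map_eq
  rw [hT] at hmap
  rw [uniformLaw, ProbabilityTheory.cond, Measure.map_smul, hmap]

lemma map_inner_uniformLaw_linearIsometryEquiv {V : Type*} [NormedAddCommGroup V]
    [InnerProductSpace ℝ V] [FiniteDimensional ℝ V] [MeasurableSpace V] [BorelSpace V] {K : Set V}
    (T : V ≃ₗᵢ[ℝ] V) (hT : T ⁻¹' K = K) (θ : V) :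
    (uniformLaw K).map (inner ℝ (T θ) ·) = (uniformLaw K).map (inner ℝ θ ·) := by
  conv_lhs => rw [← uniformLaw_map_linearIsometryEquiv T hT]
  rw [Measure.map_map (by fun_prop) (by fun_prop)]
  exact Measure.map_congr (ae_of_all _ (T.inner_map_map θ))

section Marginal

variable {N : ℕ} {p : ℝ} {K : Set (EuclideanSpace ℝ (Fin N))}
  {E : Submodule ℝ (EuclideanSpace ℝ (Fin N))} {θ : EuclideanSpace ℝ (Fin N)}

lemma marginalLaw_eq_map_inner (K : Set (EuclideanSpace ℝ (Fin N))) (hθ : θ ∈ E) :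
    marginalLaw K E θ = (uniformLaw K).map (inner ℝ θ ·) := by
  unfold marginalLaw
  congr with x
  rw [← Submodule.inner_starProjection_left_eq_right, Submodule.starProjection_eq_self_iff.2 hθ]

lemma marginalLaw_singleton_zero_eq_zero (K : Set (EuclideanSpace ℝ (Fin N))) (hθ : θ ∈ E)
    (hθ0 : θ ≠ 0) : marginalLaw K E θ {0} = 0 := by
  rw [marginalLaw_eq_map_inner K hθ, Measure.map_apply (by fun_prop) (measurableSet_singleton 0)]
  have hpre : (inner ℝ θ ·) ⁻¹' {0} = (((ℝ ∙ θ)ᗮ : Submodule ℝ _) : Set _) := by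
    ext x
    simp [Submodule.mem_orthogonal_singleton_iff_inner_right]
  rw [hpre]
  refine cond_absolutelyContinuous (Measure.addHaar_submodule _ _ fun htop ↦ hθ0 ?_)
  have hmem : θ ∈ (ℝ ∙ θ)ᗮ := htop ▸ Submodule.mem_top
  rwa [Submodule.mem_orthogonal_singleton_iff_inner_right, inner_self_eq_zero] at hmem

namespace IsPConvexBody

lemma isProbabilityMeasure_uniformLaw (hK : IsPConvexBody p K) :
    IsProbabilityMeasure (uniformLaw K) :=
  cond_isProbabilityMeasure_of_finite
    (Measure.measure_pos_of_nonempty_interior volume hK.nonempty_interior).ne'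
    hK.isCompact.measure_lt_top.ne

lemma isProbabilityMeasure_marginalLaw (hK : IsPConvexBody p K)
    (E : Submodule ℝ (EuclideanSpace ℝ (Fin N))) (θ : EuclideanSpace ℝ (Fin N)) :
    IsProbabilityMeasure (marginalLaw K E θ) := by
  have := hK.isProbabilityMeasure_uniformLaw
  exact Measure.isProbabilityMeasure_map (by fun_prop)

lemma isNegInvariant_marginalLaw (hK : IsPConvexBody p K) (hθ : θ ∈ E) :
    (marginalLaw K E θ).IsNegInvariant where
  neg_eq_self := by
    have hneg := map_inner_uniformLaw_linearIsometryEquiv (LinearIsometryEquiv.neg ℝ)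
      hK.isPConvex.1.symm θ
    rw [marginalLaw_eq_map_inner K hθ, Measure.neg, Measure.map_map (by fun_prop) (by fun_prop)]
    convert hneg using 2
    ext x
    simp

lemma exists_marginalLaw_Ioi_eq_zero (hK : IsPConvexBody p K) (hθ : θ ∈ E) :
    ∃ r, marginalLaw K E θ (Set.Ioi r) = 0 := by
  obtain ⟨r, hr⟩ := (hK.isCompact.image (f := (inner ℝ θ ·)) (by fun_prop)).bddAbove
  refine ⟨r, ?_⟩
  rw [marginalLaw_eq_map_inner K hθ, Measure.map_apply (by fun_prop) measurableSet_Ioi]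
  exact measure_mono_null (fun x hx hxK ↦ (hr (Set.mem_image_of_mem _ hxK)).not_gt hx)
    (ae_cond_mem hK.isCompact.measurableSet)

lemma marginalLaw_ne_gaussianReal (hK : IsPConvexBody p K) (hθ : θ ∈ E) (hθ0 : θ ≠ 0)
    (v : ℝ≥0) : marginalLaw K E θ ≠ gaussianReal 0 v := by
  intro heq
  rcases eq_or_ne v 0 with rfl | hv
  · have hzero := marginalLaw_singleton_zero_eq_zero K hθ hθ0
    simp [heq] at hzero
  · obtain ⟨r, hr⟩ := hK.exists_marginalLaw_Ioi_eq_zero hθ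
    have hvol := gaussianReal_absolutelyContinuous' 0 hv (heq ▸ hr)
    simp at hvol

lemma exists_forall_not_levyClose_marginalLaw (hK : IsPConvexBody p K) (hθ : θ ∈ E) (hθ0 : θ ≠ 0) :
    ∃ c, 0 < c ∧ ∀ m v, ¬LevyClose c (marginalLaw K E θ) (gaussianReal m v) := by
  have := hK.isProbabilityMeasure_marginalLaw E θ
  have := hK.isNegInvariant_marginalLaw hθ
  exact exists_forall_not_levyClose_gaussianReal (hK.marginalLaw_ne_gaussianReal hθ hθ0)

end IsPConvexBody

end Marginal

section Ball

lemma isPConvex_of_absConvex {V : Type*} [AddCommGroup V] [Module ℝ V] {K : Set V} {p : ℝ}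
    (hK : AbsConvex ℝ K) (hp : 0 < p) (hp1 : p ≤ 1) : IsPConvex p K := by
  refine ⟨hK.1.neg_eq.symm, fun x hx y hy l hl hl1 ↦ ?_⟩
  have hmem : ∀ {s : ℝ} {z : V}, 0 < s → s ≤ 1 → z ∈ K → s ^ (1 / p - 1) • z ∈ K := fun hs hs1 hz ↦
    hK.1.smul_mem (by
      rw [Real.norm_of_nonneg (by positivity)]
      exact Real.rpow_le_one hs.le hs1 (sub_nonneg.2 ((one_le_div hp).2 hp1))) hz
  have hsplit : ∀ {s : ℝ}, 0 < s → s ^ (1 / p) = s * s ^ (1 / p - 1) := fun hs ↦ by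
    rw [Real.rpow_sub_one hs.ne', mul_div_cancel₀ _ hs.ne']
  rw [hsplit hl, hsplit (sub_pos.2 hl1), mul_smul, mul_smul]
  exact hK.2 (hmem hl hl1.le hx) (hmem (sub_pos.2 hl1) (by linarith) hy) hl.le
    (sub_pos.2 hl1).le (by ring)

lemma isPConvex_closedBall {V : Type*} [NormedAddCommGroup V] [NormedSpace ℝ V] {p : ℝ}
    (hp : 0 < p) (hp1 : p ≤ 1) (r : ℝ) : IsPConvex p (Metric.closedBall (0 : V) r) :=
  isPConvex_of_absConvex ⟨balanced_closedBall_zero, convex_closedBall 0 r⟩ hp hp1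

lemma isPConvexBody_closedBall (N : ℕ) {p : ℝ} (hp : 0 < p) (hp1 : p ≤ 1) :
    IsPConvexBody p (Metric.closedBall (0 : EuclideanSpace ℝ (Fin N)) 1) where
  isPConvex := isPConvex_closedBall hp hp1 1
  isCompact := isCompact_closedBall 0 1
  nonempty_interior := ⟨0, Metric.ball_subset_interior_closedBall (Metric.mem_ball_self one_pos)⟩

lemma map_inner_uniformLaw_closedBall_eq {V : Type*} [NormedAddCommGroup V]
    [InnerProductSpace ℝ V] [FiniteDimensional ℝ V] [MeasurableSpace V] [BorelSpace V] {θ θ' : V}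
    (h : ‖θ‖ = ‖θ'‖) (r : ℝ) :
    (uniformLaw (Metric.closedBall 0 r)).map (inner ℝ θ ·) =
      (uniformLaw (Metric.closedBall 0 r)).map (inner ℝ θ' ·) := by
  rw [← Submodule.reflection_sub h]
  exact (map_inner_uniformLaw_linearIsometryEquiv _ (by ext; simp) θ).symm

lemma exists_forall_not_levyClose_marginalLaw_closedBall (N : ℕ) :
    ∃ c, 0 < c ∧ ∀ (E : Submodule ℝ (EuclideanSpace ℝ (Fin N))), ∀ θ ∈ E, ‖θ‖ = 1 → ∀ m v,
      ¬LevyClose c (marginalLaw (Metric.closedBall 0 1) E θ) (gaussianReal m v) := by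
  by_cases hex : ∃ θ : EuclideanSpace ℝ (Fin N), ‖θ‖ = 1
  · obtain ⟨θ₀, hθ₀⟩ := hex
    obtain ⟨c, hc, hgap⟩ := (isPConvexBody_closedBall N one_pos
      le_rfl).exists_forall_not_levyClose_marginalLaw (E := ⊤) (θ := θ₀) Submodule.mem_top
      (norm_ne_zero_iff.1 (by simp [hθ₀]))
    refine ⟨c, hc, fun E θ hθE hθ ↦ ?_⟩
    rwa [marginalLaw_eq_map_inner _ hθE, map_inner_uniformLaw_closedBall_eq (hθ.trans hθ₀.symm),
      ← marginalLaw_eq_map_inner _ (Submodule.mem_top (x := θ₀))]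
  · exact ⟨1, one_pos, fun E θ _ hθ ↦ absurd ⟨θ, hθ⟩ hex⟩

end Ball

lemma norm_map_smul_add_smul_le {V W : Type*} [SeminormedAddCommGroup V] [NormedSpace ℝ V]
    [SeminormedAddCommGroup W] [NormedSpace ℝ W] (T : V →L[ℝ] W) {α β : ℝ}
    (hα : 0 ≤ α) (hβ : 0 ≤ β) (x y : V) :
    ‖T (α • x + β • y)‖ ≤ α * ‖T x‖ + β * ‖T y‖ := by
  rw [map_add, map_smul, map_smul]
  exact (norm_add_le _ _).trans_eq (by rw [norm_smul_of_nonneg hα, norm_smul_of_nonneg hβ])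

section BodyOfRevolution

variable {V : Type*} [NormedAddCommGroup V] [InnerProductSpace ℝ V] [FiniteDimensional ℝ V]
  {E : Submodule ℝ V} {R : ℝ} {f : ℝ → ℝ}

/-- The body of revolution with axis `E` and radial profile `f`, truncated to the points whose
projection to the axis has norm at most `R`. -/
def bodyOfRevolution (E : Submodule ℝ V) (R : ℝ) (f : ℝ → ℝ) : Set V :=
  {z | ‖E.starProjection z‖ ≤ R ∧ ‖Eᗮ.starProjection z‖ ≤ f ‖E.starProjection z‖}

lemma isClosed_bodyOfRevolution (E : Submodule ℝ V) (R : ℝ) (hf : Continuous f) :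
    IsClosed (bodyOfRevolution E R f) :=
  (isClosed_le (f := fun z ↦ ‖E.starProjection z‖) (by fun_prop) continuous_const).inter
    (isClosed_le (f := fun z ↦ ‖Eᗮ.starProjection z‖) (by fun_prop)
      (hf.comp (by fun_prop : Continuous fun z ↦ ‖E.starProjection z‖)))

lemma bodyOfRevolution_subset_closedBall (hf : AntitoneOn f (Set.Ici 0)) :
    bodyOfRevolution E R f ⊆ Metric.closedBall 0 (R + f 0) := fun z hz ↦ by
  rw [mem_closedBall_zero_iff, ← E.starProjection_add_starProjection_orthogonal z]
  exact (norm_add_le _ _).trans (add_le_add hz.1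
    (hz.2.trans (hf Set.self_mem_Ici (norm_nonneg _) (norm_nonneg _))))

lemma zero_mem_interior_bodyOfRevolution (hR : 0 < R) (hf : Continuous f) (hf0 : 0 < f 0) :
    0 ∈ interior (bodyOfRevolution E R f) := by
  refine mem_interior.2 ⟨{z | ‖E.starProjection z‖ < R} ∩
    {z | ‖Eᗮ.starProjection z‖ < f ‖E.starProjection z‖}, fun z hz ↦ ⟨hz.1.le, hz.2.le⟩,
    (isOpen_lt (by fun_prop) continuous_const).inter (isOpen_lt (by fun_prop) (by fun_prop)), ?_⟩
  simp [hR, hf0]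

lemma SlowDecay.isPConvex_bodyOfRevolution {v : ℝ} (hf : SlowDecay v f) {p : ℝ} (hp : 0 < p)
    (hp1 : p ≤ 1) (hv : 0 < v) (hR : R ^ 2 ≤ convexityDefect p * v) :
    IsPConvex p (bodyOfRevolution E R f) := by
  refine ⟨by ext; simp only [bodyOfRevolution, Set.mem_neg, Set.mem_ofPred_eq, map_neg, norm_neg],
    fun x hx y hy l hl hl1 ↦ ?_⟩
  have hα : 0 ≤ l ^ (1 / p) := by positivity
  have hβ : 0 ≤ (1 - l) ^ (1 / p) := Real.rpow_nonneg (sub_nonneg.2 hl1.le) _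
  have hE := norm_map_smul_add_smul_le E.starProjection hα hβ x y
  refine ⟨?_, ?_⟩
  · have hball := (isPConvex_closedBall hp hp1 R).2 _ (mem_closedBall_zero_iff.2 hx.1) _
      (mem_closedBall_zero_iff.2 hy.1) l hl hl1
    simpa only [mem_closedBall_zero_iff, ← map_smul, ← map_add] using hball
  · calc ‖Eᗮ.starProjection (l ^ (1 / p) • x + (1 - l) ^ (1 / p) • y)‖
        ≤ l ^ (1 / p) * ‖Eᗮ.starProjection x‖ + (1 - l) ^ (1 / p) * ‖Eᗮ.starProjection y‖ :=
          norm_map_smul_add_smul_le _ hα hβ x y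
      _ ≤ l ^ (1 / p) * f ‖E.starProjection x‖ + (1 - l) ^ (1 / p) * f ‖E.starProjection y‖ := by
          gcongr
          exacts [hx.2, hy.2]
      _ ≤ f (l ^ (1 / p) * ‖E.starProjection x‖ + (1 - l) ^ (1 / p) * ‖E.starProjection y‖) :=
          hf.rpow_mul_add_le hp hp1 hv hR ⟨norm_nonneg _, hx.1⟩ ⟨norm_nonneg _, hy.1⟩
            ⟨hl.le, hl1.le⟩
      _ ≤ f ‖E.starProjection (l ^ (1 / p) • x + (1 - l) ^ (1 / p) • y)‖ :=
          hf.antitoneOn (norm_nonneg _) ((norm_nonneg _).trans hE) hE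

lemma SlowDecay.isPConvexBody_bodyOfRevolution {N : ℕ}
    {E : Submodule ℝ (EuclideanSpace ℝ (Fin N))} {v : ℝ} (hf : SlowDecay v f)
    (hcont : Continuous f) {p : ℝ} (hp : 0 < p) (hp1 : p ≤ 1) (hv : 0 < v) (hR0 : 0 < R)
    (hR : R ^ 2 ≤ convexityDefect p * v) : IsPConvexBody p (bodyOfRevolution E R f) where
  isPConvex := hf.isPConvex_bodyOfRevolution hp hp1 hv hR
  isCompact := Metric.isCompact_of_isClosed_isBounded (isClosed_bodyOfRevolution E R hcont)
    (Metric.isBounded_closedBall.subset (bodyOfRevolution_subset_closedBall hf.antitoneOn))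
  nonempty_interior := ⟨0, zero_mem_interior_bodyOfRevolution hR0 hcont (hf.pos 0)⟩

variable [MeasurableSpace V] [BorelSpace V]

lemma measurePreserving_orthogonalProjectionOnto_prod (E : Submodule ℝ V) :
    MeasurePreserving fun z ↦
      ((E.orthogonalProjectionOnto z, Eᗮ.orthogonalProjectionOnto z) : E × Eᗮ) := by
  convert (WithLp.volume_preserving_ofLp E Eᗮ).comp E.orthogonalDecomposition.measurePreserving
    using 1
  ext z <;> simp

lemma volume_bodyOfRevolution_inter_preimage (E : Submodule ℝ V) (R : ℝ) (hf : Continuous f)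
    (hf0 : ∀ ρ, 0 ≤ f ρ) {A : Set E} (hA : MeasurableSet A) :
    volume (bodyOfRevolution E R f ∩ E.orthogonalProjectionOnto ⁻¹' A) =
      volume (Metric.ball (0 : Eᗮ) 1) *
        volume.withDensity (fun x : E ↦ ENNReal.ofReal (f ‖x‖ ^ Module.finrank ℝ Eᗮ))
          (Metric.closedBall 0 R ∩ A) := by
  set B : Set E := Metric.closedBall 0 R ∩ A
  have hB : MeasurableSet B := measurableSet_closedBall.inter hA
  set S : Set (E × Eᗮ) := {q | q.1 ∈ B ∧ ‖q.2‖ ≤ f ‖q.1‖}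
  have hS : MeasurableSet S :=
    (measurable_fst hB).inter (measurableSet_le (f := fun q : E × Eᗮ ↦ ‖q.2‖) (by fun_prop)
      (hf.measurable.comp measurable_fst.norm))
  have hpre : bodyOfRevolution E R f ∩ E.orthogonalProjectionOnto ⁻¹' A =
      (fun z ↦ (E.orthogonalProjectionOnto z, Eᗮ.orthogonalProjectionOnto z)) ⁻¹' S := by
    ext z
    simp only [bodyOfRevolution, S, B, Set.mem_inter_iff, Set.mem_preimage, Set.mem_ofPred_eq,
      mem_closedBall_zero_iff, Submodule.starProjection_apply, Submodule.coe_norm]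
    tauto
  have hfiber : ∀ x, volume (Prod.mk x ⁻¹' S) = B.indicator (fun x ↦
      volume (Metric.ball (0 : Eᗮ) 1) * ENNReal.ofReal (f ‖x‖ ^ Module.finrank ℝ Eᗮ)) x := by
    intro x
    by_cases hx : x ∈ B
    · have hball : Prod.mk x ⁻¹' S = Metric.closedBall (0 : Eᗮ) (f ‖x‖) := by ext y; simp [S, hx]
      rw [hball, Measure.addHaar_closedBall _ _ (hf0 _), Set.indicator_of_mem hx, mul_comm]
    · simp [S, hx]
  rw [hpre, (measurePreserving_orthogonalProjectionOnto_prod E).measure_preimage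
    hS.nullMeasurableSet, Measure.volume_eq_prod, Measure.prod_apply hS, lintegral_congr hfiber,
    lintegral_indicator hB, lintegral_const_mul _ (by fun_prop), withDensity_apply _ hB]

lemma map_orthogonalProjectionOnto_uniformLaw_bodyOfRevolution (E : Submodule ℝ V) (R : ℝ)
    (hf : Continuous f) (hf0 : ∀ ρ, 0 ≤ f ρ) :
    (uniformLaw (bodyOfRevolution E R f)).map E.orthogonalProjectionOnto =
      cond (volume.withDensity fun x : E ↦ ENNReal.ofReal (f ‖x‖ ^ Module.finrank ℝ Eᗮ))
        (Metric.closedBall 0 R) := by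
  set ω := volume (Metric.ball (0 : Eᗮ) 1)
  have hω0 : ω ≠ 0 := (Metric.measure_ball_pos volume _ one_pos).ne'
  have hω : ω ≠ ∞ := measure_ball_lt_top.ne
  have hvol := volume_bodyOfRevolution_inter_preimage E R hf hf0 .univ
  rw [Set.preimage_univ, Set.inter_univ, Set.inter_univ] at hvol
  ext A hA
  rw [Measure.map_apply (by fun_prop) hA, uniformLaw,
    cond_apply (isClosed_bodyOfRevolution E R hf).measurableSet,
    cond_apply measurableSet_closedBall,
    volume_bodyOfRevolution_inter_preimage E R hf hf0 hA, hvol,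
    ← ENNReal.div_eq_inv_mul, ← ENNReal.div_eq_inv_mul, ENNReal.mul_div_mul_left _ _ hω0 hω]

lemma marginalLaw_bodyOfRevolution {N : ℕ} {E : Submodule ℝ (EuclideanSpace ℝ (Fin N))} (R : ℝ)
    (hf : Continuous f) (hf0 : ∀ ρ, 0 ≤ f ρ) (θ : E) :
    marginalLaw (bodyOfRevolution E R f) E θ =
      (cond (volume.withDensity fun x : E ↦ ENNReal.ofReal (f ‖x‖ ^ Module.finrank ℝ Eᗮ))
        (Metric.closedBall 0 R)).map (inner ℝ θ ·) := by
  rw [← map_orthogonalProjectionOnto_uniformLaw_bodyOfRevolution E R hf hf0,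
    Measure.map_map (by fun_prop) (by fun_prop)]
  rfl

end BodyOfRevolution

lemma abs_real_cond_sub_real_le {Ω : Type*} [MeasurableSpace Ω] (γ : Measure Ω)
    [IsProbabilityMeasure γ] {B : Set Ω} (hB : MeasurableSet B) (A : Set Ω) :
    |(cond γ B).real A - γ.real A| ≤ γ.real Bᶜ := by
  have hinter : (cond γ B).real A * γ.real B = γ.real (A ∩ B) := by
    rw [measureReal_def, measureReal_def, ← ENNReal.toReal_mul, cond_mul_eq_inter hB,
      Set.inter_comm, measureReal_def]
  have hsplit : γ.real (A ∩ B) + γ.real (A \ B) = γ.real A := measureReal_inter_add_sdiff hB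
  have hdiff : γ.real (A \ B) ≤ γ.real Bᶜ := measureReal_mono fun x hx ↦ hx.2
  have hcond : (cond γ B).real A ≤ 1 := measureReal_le_one
  have hcompl : γ.real Bᶜ = 1 - γ.real B := probReal_compl_eq_one_sub hB
  rw [abs_sub_le_iff]
  constructor <;> nlinarith [measureReal_nonneg (μ := cond γ B) (s := A),
    measureReal_nonneg (μ := γ) (s := A \ B), measureReal_nonneg (μ := γ) (s := Bᶜ)]

section MixtureBody

variable {V : Type*} [NormedAddCommGroup V] [InnerProductSpace ℝ V] [FiniteDimensional ℝ V]
  [MeasurableSpace V] [BorelSpace V] {N : ℕ} {E : Submodule ℝ (EuclideanSpace ℝ (Fin N))}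
  {U : Measure ℝ} [IsProbabilityMeasure U] {a b p R : ℝ}

/-- The radial profile for which the body of revolution in `ℝ ^ (d + M)` with a `d`-dimensional axis
projects to the restriction of the Gaussian mixture to a ball: the fibers of the projection to the
axis are `M`-dimensional balls, so the profile is the `M`-th root of the density. -/
noncomputable def mixtureProfile (U : Measure ℝ) (d M : ℕ) (ρ : ℝ) : ℝ :=
  mixtureDensity U d ρ ^ (M : ℝ)⁻¹

lemma continuous_mixtureProfile (ha : 0 < a) (hU : ∀ᵐ w ∂U, a ≤ w) (d M : ℕ) :
    Continuous (mixtureProfile U d M) :=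
  (continuous_mixtureDensity ha hU d).rpow_const fun _ ↦ Or.inr (by positivity)

lemma slowDecay_mixtureProfile (ha : 0 < a) (hU : ∀ᵐ w ∂U, a ≤ w) (d : ℕ) {M : ℕ} (hM : M ≠ 0) :
    SlowDecay (M * a ^ 2) (mixtureProfile U d M) :=
  (slowDecay_mixtureDensity ha hU d).rpow_inv (by positivity)

lemma marginalLaw_bodyOfRevolution_mixtureProfile (ha : 0 < a) (hU : ∀ᵐ w ∂U, a ≤ w)
    (hE : Module.finrank ℝ Eᗮ ≠ 0) (R : ℝ) (θ : E) :
    marginalLaw (bodyOfRevolution E R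
        (mixtureProfile U (Module.finrank ℝ E) (Module.finrank ℝ Eᗮ))) E θ =
      (cond (gaussianMixture E U) (Metric.closedBall 0 R)).map (inner ℝ θ ·) := by
  have hdecay := slowDecay_mixtureDensity ha hU (Module.finrank ℝ E)
  rw [marginalLaw_bodyOfRevolution R (continuous_mixtureProfile ha hU _ _)
    fun ρ ↦ ((slowDecay_mixtureProfile ha hU _ hE).pos ρ).le, gaussianMixture_eq_withDensity ha hU]
  simp_rw [mixtureProfile, Real.rpow_inv_natCast_pow (hdecay.pos _).le hE]

lemma abs_real_map_inner_cond_closedBall_sub_le (hU : ∀ᵐ w ∂U, |w| ≤ b) (hR : 0 ≤ R)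
    (hbR : 8 * b ^ 2 * Module.finrank ℝ V ≤ R ^ 2) {θ : V} (hθ : ‖θ‖ = 1) {A : Set ℝ}
    (hA : MeasurableSet A) :
    |((cond (gaussianMixture V U) (Metric.closedBall 0 R)).map (inner ℝ θ ·)).real A -
      (gaussianMixture ℝ U).real A| ≤ Real.exp (-Module.finrank ℝ V) := by
  have hcompl : (Metric.closedBall (0 : V) R)ᶜ = {x | R < ‖x‖} := by ext; simp
  rw [← map_inner_gaussianMixture U hθ, map_measureReal_apply (by fun_prop) hA,
    map_measureReal_apply (by fun_prop) hA]
  calc _ ≤ (gaussianMixture V U).real (Metric.closedBall 0 R)ᶜ :=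
        abs_real_cond_sub_real_le _ measurableSet_closedBall _
    _ ≤ Real.exp (-Module.finrank ℝ V) :=
        ENNReal.toReal_le_of_le_ofReal (Real.exp_pos _).le
          (hcompl ▸ gaussianMixture_norm_gt_le hU hR hbR)

lemma exists_isPConvexBody_abs_real_marginalLaw_sub_le (hp : 0 < p) (hp1 : p ≤ 1) (ha : 0 < a)
    (hU : ∀ᵐ w ∂U, w ∈ Set.Icc a b) (hE : 0 < Module.finrank ℝ E)
    (hcodim : 8 * b ^ 2 * Module.finrank ℝ E ≤
      convexityDefect p * (Module.finrank ℝ Eᗮ * a ^ 2)) :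
    ∃ K, IsPConvexBody p K ∧ ∀ θ ∈ E, ‖θ‖ = 1 → ∀ A, MeasurableSet A →
      |(marginalLaw K E θ).real A - (gaussianMixture ℝ U).real A| ≤
        Real.exp (-Module.finrank ℝ E) := by
  have hUa : ∀ᵐ w ∂U, a ≤ w := hU.mono fun w hw ↦ hw.1
  have hUb : ∀ᵐ w ∂U, |w| ≤ b := hU.mono fun w hw ↦ (abs_of_pos (ha.trans_le hw.1)).trans_le hw.2
  obtain ⟨w, haw, hwb⟩ := hU.exists
  have hb : 0 < b := ha.trans_le (haw.trans hwb)
  set R := √(8 * b ^ 2 * Module.finrank ℝ E)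
  have hR : R ^ 2 = 8 * b ^ 2 * Module.finrank ℝ E := Real.sq_sqrt (by positivity)
  have hR0 : 0 < R := Real.sqrt_pos.2 (by positivity)
  have hM : Module.finrank ℝ Eᗮ ≠ 0 := fun h ↦ by
    rw [h, Nat.cast_zero, zero_mul, mul_zero, ← hR] at hcodim
    exact hcodim.not_gt (by positivity)
  refine ⟨bodyOfRevolution E R (mixtureProfile U (Module.finrank ℝ E) (Module.finrank ℝ Eᗮ)),
    (slowDecay_mixtureProfile ha hUa _ hM).isPConvexBody_bodyOfRevolution
      (continuous_mixtureProfile ha hUa _ _) hp hp1 (by positivity) hR0 (hR.trans_le hcodim),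
    fun θ hθE hθ A hA ↦ ?_⟩
  have hlaw := marginalLaw_bodyOfRevolution_mixtureProfile ha hUa hM R ⟨θ, hθE⟩
  rw [hlaw]
  exact abs_real_map_inner_cond_closedBall_sub_le (θ := (⟨θ, hθE⟩ : E)) hUb hR0.le hR.ge hθ hA

end MixtureBody

lemma exists_submodule_finrank_eq {k V : Type*} [DivisionRing k] [AddCommGroup V] [Module k V]
    [FiniteDimensional k V] {n : ℕ} (hn : n ≤ Module.finrank k V) :
    ∃ E : Submodule k V, Module.finrank k E = n := by
  obtain ⟨f, hf⟩ := exists_linearIndependent_of_le_finrank hn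
  exact ⟨Submodule.span k (Set.range f), (finrank_span_eq_card hf).trans (Fintype.card_fin n)⟩

/-- Some `p`-convex body in `ℝ ^ N` has marginals along an `n`-dimensional subspace all of which
are within `c⁻¹ * exp (-n)` of `μ` in total variation and at Lévy distance more than `c` from
every Gaussian law. A single constant `c` governs both properties, so that the predicate gets
weaker as `c` decreases to `0`. -/
def HasNonGaussianMarginals (p : ℝ) (μ : Measure ℝ) (n N : ℕ) (c : ℝ) : Prop :=
  ∃ K : Set (EuclideanSpace ℝ (Fin N)), IsPConvexBody p K ∧
    ∃ E : Submodule ℝ (EuclideanSpace ℝ (Fin N)), Module.finrank ℝ E = n ∧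
      ∀ θ ∈ E, ‖θ‖ = 1 →
        (∀ A, MeasurableSet A →
          |(marginalLaw K E θ).real A - μ.real A| ≤ c⁻¹ * Real.exp (-n)) ∧
        ∀ m v, ¬LevyClose c (marginalLaw K E θ) (gaussianReal m v)

namespace HasNonGaussianMarginals

variable {p c c' : ℝ} {μ : Measure ℝ} {n N : ℕ}

lemma anti (h : HasNonGaussianMarginals p μ n N c) (hc' : 0 < c') (hcc' : c' ≤ c) :
    HasNonGaussianMarginals p μ n N c' := by
  obtain ⟨K, hK, E, hE, h⟩ := h
  refine ⟨K, hK, E, hE, fun θ hθE hθ ↦ ⟨fun A hA ↦ ((h θ hθE hθ).1 A hA).trans ?_,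
    fun m v hclose ↦ ?_⟩⟩
  · gcongr
  · have := hK.isProbabilityMeasure_marginalLaw E θ
    exact (h θ hθE hθ).2 m v (hclose.mono hcc')

lemma exists_of_le [IsProbabilityMeasure μ] (hp : 0 < p) (hp1 : p ≤ 1) (hn : n ≤ N) :
    ∃ c, 0 < c ∧ HasNonGaussianMarginals p μ n N c := by
  obtain ⟨c, hc, hfar⟩ := exists_forall_not_levyClose_marginalLaw_closedBall N
  obtain ⟨E, hE⟩ := exists_submodule_finrank_eq (k := ℝ) (V := EuclideanSpace ℝ (Fin N))
    (hn.trans_eq finrank_euclideanSpace_fin.symm)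
  have hK := isPConvexBody_closedBall N hp hp1
  have hmin : 0 < min c (Real.exp (-n)) := lt_min hc (Real.exp_pos _)
  refine ⟨min c (Real.exp (-n)), hmin, _, hK, E, hE, fun θ hθE hθ ↦ ?_⟩
  have := hK.isProbabilityMeasure_marginalLaw E θ
  refine ⟨fun A _ ↦ ?_, fun m v hclose ↦ hfar E θ hθE hθ m v (hclose.mono (min_le_left _ _))⟩
  calc |(marginalLaw (Metric.closedBall 0 1) E θ).real A - μ.real A|
      ≤ 1 := abs_sub_le_of_nonneg_of_le measureReal_nonneg measureReal_le_one measureReal_nonneg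
        measureReal_le_one
    _ ≤ (min c (Real.exp (-n)))⁻¹ * Real.exp (-n) :=
        (le_inv_mul_iff₀ hmin).2 ((mul_one _).trans_le (min_le_right _ _))

lemma of_gaussianMixture {U : Measure ℝ} [IsProbabilityMeasure U] {a b : ℝ} (hp : 0 < p)
    (hp1 : p ≤ 1) (ha : 0 < a) (hU : ∀ᵐ w ∂U, w ∈ Set.Icc a b) (hn : 1 ≤ n)
    (hnN : (8 * b ^ 2 + convexityDefect p * a ^ 2) * n ≤ convexityDefect p * a ^ 2 * N)
    (hle : n ≤ N) (hc : 0 < c) (hc1 : c ≤ 1) (hexp : Real.exp (-n) ≤ c)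
    (hfar : ∀ m v, ¬LevyClose (c + c) (gaussianMixture ℝ U) (gaussianReal m v)) :
    HasNonGaussianMarginals p (gaussianMixture ℝ U) n N c := by
  obtain ⟨E, hE⟩ := exists_submodule_finrank_eq (k := ℝ) (V := EuclideanSpace ℝ (Fin N))
    (hle.trans_eq finrank_euclideanSpace_fin.symm)
  have hcodim : (n + Module.finrank ℝ Eᗮ : ℝ) = N := by
    exact_mod_cast hE ▸ E.finrank_add_finrank_orthogonal.trans finrank_euclideanSpace_fin
  obtain ⟨K, hK, hclose⟩ := exists_isPConvexBody_abs_real_marginalLaw_sub_le (E := E) hp hp1 ha hU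
    (hE ▸ hn) (by rw [hE]; rw [← hcodim] at hnN; linarith)
  rw [hE] at hclose
  refine ⟨K, hK, E, hE, fun θ hθE hθ ↦ ⟨fun A hA ↦ (hclose θ hθE hθ A hA).trans ?_,
    fun m v hlevy ↦ hfar m v ?_⟩⟩
  · exact le_mul_of_one_le_left (Real.exp_pos _).le ((one_le_inv₀ hc).2 hc1)
  · have := hK.isProbabilityMeasure_marginalLaw E θ
    exact hlevy.of_abs_real_Iic_sub_le fun t ↦
      (hclose θ hθE hθ _ measurableSet_Iic).trans hexp

end HasNonGaussianMarginals

lemma exists_forall_of_forall_exists_of_eventually {P : ℕ → ℝ → Prop}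
    (hanti : ∀ n c c', P n c → 0 < c' → c' ≤ c → P n c') (hex : ∀ n, ∃ c, 0 < c ∧ P n c)
    {c₀ : ℝ} (hc₀ : 0 < c₀) (hev : ∀ᶠ n in atTop, P n c₀) : ∃ c, 0 < c ∧ c ≤ c₀ ∧ ∀ n, P n c := by
  obtain ⟨n₀, hn₀⟩ := eventually_atTop.1 hev
  have hsmall : ∀ᶠ c in 𝓝[>] (0 : ℝ), ∀ n ∈ Finset.range n₀, P n c := by
    refine (eventually_all_finset _).2 fun n _ ↦ ?_
    obtain ⟨c, hc, hP⟩ := hex n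
    filter_upwards [Ioc_mem_nhdsGT hc] with c' hc' using hanti n c c' hP hc'.1 hc'.2
  obtain ⟨c, hc, hP⟩ := (hsmall.and (Ioc_mem_nhdsGT hc₀)).exists
  refine ⟨c, hP.1, hP.2, fun n ↦ ?_⟩
  obtain hn | hn := lt_or_ge n n₀
  · exact hc n (Finset.mem_range.2 hn)
  · exact hanti n c₀ c (hn₀ n hn) hP.1 hP.2

lemma exists_forall_hasNonGaussianMarginals {p : ℝ} (hp : 0 < p) (hp1 : p < 1) {U : Measure ℝ}
    [IsProbabilityMeasure U] {a b : ℝ} (ha : 0 < a) (hU : ∀ᵐ w ∂U, w ∈ Set.Icc a b)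
    (hdirac : ∀ w, U ≠ .dirac w) {N : ℕ → ℕ} (hnN : ∀ n, n ≤ N n)
    (hN : (fun n : ℕ ↦ (n : ℝ)) =o[atTop] fun n ↦ (N n : ℝ)) :
    ∃ c, 0 < c ∧ c ≤ 1 ∧ ∀ n, HasNonGaussianMarginals p (gaussianMixture ℝ U) n (N n) c := by
  obtain ⟨c, hc, hfar⟩ := exists_forall_not_levyClose_gaussianReal
    (gaussianMixture_ne_gaussianReal (hU.mono fun w hw ↦ ha.trans_le hw.1) hdirac)
  have hκ := mul_pos (convexityDefect_pos hp hp1) (pow_pos ha 2)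
  have hδ : 0 < min (c / 2) 1 := lt_min (half_pos hc) one_pos
  have hfar' : ∀ m v, ¬LevyClose (min (c / 2) 1 + min (c / 2) 1) (gaussianMixture ℝ U)
      (gaussianReal m v) := fun m v h ↦ hfar m v (h.mono (by linarith [min_le_left (c / 2) 1]))
  have hcodim : ∀ᶠ n : ℕ in atTop,
      (8 * b ^ 2 + convexityDefect p * a ^ 2) * n ≤ convexityDefect p * a ^ 2 * N n := by
    filter_upwards [hN.def (div_pos hκ (by positivity :
      0 < 8 * b ^ 2 + convexityDefect p * a ^ 2))] with n hn
    rwa [Real.norm_natCast, Real.norm_natCast, div_mul_eq_mul_div, le_div_iff₀' (by positivity)]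
      at hn
  have hexp : ∀ᶠ n : ℕ in atTop, Real.exp (-n) ≤ min (c / 2) 1 :=
    ((Real.tendsto_exp_neg_atTop_nhds_zero.comp tendsto_natCast_atTop_atTop).eventually
      (gt_mem_nhds hδ)).mono fun n hn ↦ hn.le
  obtain ⟨c', hc', hle, h⟩ := exists_forall_of_forall_exists_of_eventually
    (P := fun n ↦ HasNonGaussianMarginals p (gaussianMixture ℝ U) n (N n))
    (fun n _ _ h ↦ h.anti) (fun n ↦ HasNonGaussianMarginals.exists_of_le hp hp1.le (hnN n)) hδ (by
      filter_upwards [eventually_ge_atTop 1, hcodim, hexp] with n hn hcodim hexp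
      exact .of_gaussianMixture hp hp1.le ha hU hn hcodim (hnN n) hδ (min_le_right _ _) hexp hfar')
  exact ⟨c', hc', hle.trans (min_le_right _ _), h⟩

theorem theorem1p2_general {p : ℝ} (hp : 0 < p) (hp1 : p < 1) {U : Measure ℝ}
    [IsProbabilityMeasure U] {a b : ℝ} (ha : 0 < a) (hU : ∀ᵐ w ∂U, w ∈ Set.Icc a b)
    (hdirac : ∀ w, U ≠ .dirac w) {N : ℕ → ℕ} (hnN : ∀ n, n ≤ N n)
    (hN : (fun n : ℕ ↦ (n : ℝ)) =o[atTop] fun n ↦ (N n : ℝ)) :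
    (∃ c : ℝ, 0 < c ∧ ∃ C : ℝ, 0 < C ∧ ∀ n,
      ∃ K : Set (EuclideanSpace ℝ (Fin (N n))), IsPConvexBody p K ∧
      ∃ E : Submodule ℝ (EuclideanSpace ℝ (Fin (N n))), Module.finrank ℝ E = n ∧
      ∀ θ ∈ E, ‖θ‖ = 1 →
        (∀ A, MeasurableSet A →
          |(marginalLaw K E θ).real A - (gaussianMixture ℝ U).real A| ≤ C * Real.exp (-n)) ∧
        ∀ (m : ℝ) (v : ℝ≥0),
          c ≤ kolmogorovDist (marginalLaw K E θ) (gaussianReal m v) ∧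
          ENNReal.ofReal c ≤ wassersteinDist (marginalLaw K E θ) (gaussianReal m v) ∧
          ENNReal.ofReal c ≤ levyProkhorovEDist (marginalLaw K E θ) (gaussianReal m v)) ∧
    ¬ ∃ ε : ℕ → ℝ, Tendsto ε atTop (𝓝 0) ∧ ∀ n : ℕ, 1 ≤ n →
      ∀ (M : ℕ) (K : Set (EuclideanSpace ℝ (Fin M))), IsPConvexBody p K →
      ∀ E : Submodule ℝ (EuclideanSpace ℝ (Fin M)), Module.finrank ℝ E = n →
      ∃ θ ∈ E, ‖θ‖ = 1 ∧ ∃ (m : ℝ) (v : ℝ≥0),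
        kolmogorovDist (marginalLaw K E θ) (gaussianReal m v) ≤ ε n := by
  obtain ⟨c, hc, hc1, h⟩ := exists_forall_hasNonGaussianMarginals hp hp1 ha hU hdirac hnN hN
  refine ⟨⟨c ^ 2, by positivity, c⁻¹, by positivity, fun n ↦ ?_⟩, fun ⟨ε, hε, hclt⟩ ↦ ?_⟩
  · obtain ⟨K, hK, E, hE, hmarg⟩ := h n
    refine ⟨K, hK, E, hE, fun θ hθE hθ ↦ ⟨(hmarg θ hθE hθ).1, fun m v ↦ ?_⟩⟩
    have := hK.isProbabilityMeasure_marginalLaw E θ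
    exact sq_le_dist_of_not_levyClose hc hc1 ((hmarg θ hθE hθ).2 m v)
  · obtain ⟨n, hn, hεn⟩ := ((eventually_ge_atTop 1).and
      (hε.eventually (gt_mem_nhds (pow_pos hc 2)))).exists
    obtain ⟨K, hK, E, hE, hmarg⟩ := h n
    obtain ⟨θ, hθE, hθ, m, v, hle⟩ := hclt n hn _ K hK E hE
    have := hK.isProbabilityMeasure_marginalLaw E θ
    have hfar := (sq_le_dist_of_not_levyClose hc hc1 ((hmarg θ hθE hθ).2 m v)).1
    exact (hfar.trans hle).not_gt hεn

lemma exp_neg_le_inv_sqrt {x : ℝ} (hx : 0 < x) : Real.exp (-x) ≤ (√x)⁻¹ := by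
  rw [Real.exp_neg]
  gcongr
  rw [Real.sqrt_le_left (Real.exp_pos x).le, ← Real.exp_nat_mul]
  linarith [Real.add_one_le_exp ((2 : ℕ) * x), show ((2 : ℕ) : ℝ) * x = 2 * x by norm_num]

lemma isProbabilityMeasure_uniformLaw_Icc {a b : ℝ} (hab : a < b) :
    IsProbabilityMeasure (uniformLaw (Set.Icc a b)) :=
  cond_isProbabilityMeasure_of_finite (by simpa using hab) (by simp)

lemma ae_mem_uniformLaw_Icc (a b : ℝ) : ∀ᵐ w ∂uniformLaw (Set.Icc a b), w ∈ Set.Icc a b :=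
  ae_cond_mem measurableSet_Icc

lemma uniformLaw_ne_dirac {V : Type*} [MeasureSpace V] [MeasurableSingletonClass V]
    [NullSingletonClass (volume : Measure V)] (K : Set V) (x : V) :
    uniformLaw K ≠ .dirac x := fun h ↦ by
  have hatom : uniformLaw K {x} = 0 := cond_absolutelyContinuous (measure_singleton x)
  simp [h] at hatom

lemma absGaussianMulUniformLaw_eq_map_abs :
    absGaussianMulUniformLaw =
      (gaussianMixture ℝ (uniformLaw (Set.Icc √(3 / 7) (2 * √(3 / 7))))).map (|·|) := by
  have hpos : ∀ᵐ w ∂uniformLaw (Set.Icc √(3 / 7) (2 * √(3 / 7))), 0 ≤ w :=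
    (ae_mem_uniformLaw_Icc _ _).mono fun w hw ↦ (Real.sqrt_nonneg _).trans hw.1
  have := isProbabilityMeasure_uniformLaw_Icc
    (lt_two_mul_self (by positivity : 0 < √(3 / 7 : ℝ)))
  rw [absGaussianMulUniformLaw, gaussianMixture, stdGaussian_real,
    Measure.map_map (by fun_prop) (by fun_prop)]
  refine Measure.map_congr ?_
  filter_upwards [Measure.quasiMeasurePreserving_snd.ae hpos] with q hq
  simp only [Function.comp_apply, smul_eq_mul, abs_mul, abs_of_nonneg hq, mul_comm]

lemma isLittleO_natCast_ambientDim :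
    (fun n : ℕ ↦ (n : ℝ)) =o[atTop] fun n ↦ (ambientDim n : ℝ) := by
  have hone : (fun _ : ℕ ↦ (1 : ℝ)) =o[atTop] fun n : ℕ ↦ (n : ℝ) ^ (3 / 2 : ℝ) :=
    (Asymptotics.isLittleO_one_left_iff ℝ).2 <| tendsto_norm_atTop_atTop.comp <|
      (tendsto_rpow_atTop (by norm_num)).comp tendsto_natCast_atTop_atTop
  have hpow : (fun n : ℕ ↦ (n : ℝ)) =o[atTop] fun n : ℕ ↦ (n : ℝ) ^ (5 / 2 : ℝ) := by
    refine ((Asymptotics.isBigO_refl (fun n : ℕ ↦ (n : ℝ)) atTop).mul_isLittleO hone).congr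
      (fun n ↦ mul_one _) fun n ↦ ?_
    rw [← Real.rpow_one_add' (by positivity) (by norm_num)]
    norm_num
  refine hpow.trans_isBigO (.of_norm_eventuallyLE ?_)
  filter_upwards [eventually_ge_atTop 3] with n hn
  have hlog : 1 ≤ Real.log n := by
    rw [Real.le_log_iff_exp_le (by positivity)]
    exact Real.exp_one_lt_three.le.trans (by exact_mod_cast hn)
  rw [Real.norm_of_nonneg (by positivity)]
  calc (n : ℝ) ^ (5 / 2 : ℝ) ≤ n ^ (5 / 2 : ℝ) * Real.log n ^ 2 :=
        le_mul_of_one_le_right (by positivity) (one_le_pow₀ hlog)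
    _ ≤ ⌈(n : ℝ) ^ (5 / 2 : ℝ) * Real.log n ^ 2⌉₊ := Nat.le_ceil _
    _ ≤ ambientDim n := by exact_mod_cast Nat.le_add_left _ _

theorem theorem1p2 :
    (∃ c : ℝ, 0 < c ∧ ∃ C : ℝ, 0 < C ∧ ∀ n : ℕ, 1 ≤ n →
      ∃ K : Set (EuclideanSpace ℝ (Fin (ambientDim n))), IsPConvexBody (1 / 2) K ∧
      ∃ E : Submodule ℝ (EuclideanSpace ℝ (Fin (ambientDim n))), Module.finrank ℝ E = n ∧
      ∀ θ ∈ E, ‖θ‖ = 1 →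
        -- the law of `|θ · Proj_E X|` is close to the law of `|G| W`
        (∀ t : ℝ, ∃ s : ℝ, |s - 1| ≤ C * (n : ℝ) ^ (-(1 / 2) + 1 / 100 : ℝ) ∧
          |(marginalLaw K E θ).real {x | |x| ≤ t} -
            absGaussianMulUniformLaw.real (Set.Iic (t * s))| ≤ C / √(n : ℝ)) ∧
        -- and `θ · Proj_E X` is far from every Gaussian
        ∀ (m : ℝ) (v : ℝ≥0),
          c ≤ kolmogorovDist (marginalLaw K E θ) (gaussianReal m v) ∧
          ENNReal.ofReal c ≤ wassersteinDist (marginalLaw K E θ) (gaussianReal m v) ∧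
          ENNReal.ofReal c ≤ levyProkhorovEDist (marginalLaw K E θ) (gaussianReal m v)) ∧
    -- no central limit theorem for marginals of `1/2`-convex bodies
    ¬ ∃ ε : ℕ → ℝ, Tendsto ε atTop (𝓝 0) ∧ ∀ n : ℕ, 1 ≤ n →
      ∀ (M : ℕ) (K : Set (EuclideanSpace ℝ (Fin M))), IsPConvexBody (1 / 2) K →
      ∀ E : Submodule ℝ (EuclideanSpace ℝ (Fin M)), Module.finrank ℝ E = n →
      ∃ θ ∈ E, ‖θ‖ = 1 ∧ ∃ (m : ℝ) (v : ℝ≥0),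
        kolmogorovDist (marginalLaw K E θ) (gaussianReal m v) ≤ ε n := by
  have ha : 0 < √(3 / 7 : ℝ) := by positivity
  have := isProbabilityMeasure_uniformLaw_Icc (lt_two_mul_self ha)
  obtain ⟨⟨c, hc, C, hC, h⟩, hclt⟩ := theorem1p2_general (p := 1 / 2) (by norm_num) (by norm_num)
    ha (ae_mem_uniformLaw_Icc √(3 / 7) (2 * √(3 / 7))) (uniformLaw_ne_dirac _)
    (fun n ↦ Nat.le_add_right n _) isLittleO_natCast_ambientDim
  refine ⟨⟨c, hc, C, hC, fun n hn ↦ ?_⟩, hclt⟩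
  obtain ⟨K, hK, E, hE, hmarg⟩ := h n
  refine ⟨K, hK, E, hE, fun θ hθE hθ ↦
    ⟨fun t ↦ ⟨1, by rw [sub_self, abs_zero]; positivity, ?_⟩, (hmarg θ hθE hθ).2⟩⟩
  rw [mul_one, absGaussianMulUniformLaw_eq_map_abs,
    map_measureReal_apply measurable_abs measurableSet_Iic]
  exact ((hmarg θ hθE hθ).1 _ (measurable_abs measurableSet_Iic)).trans
    (mul_le_mul_of_nonneg_left (exp_neg_le_inv_sqrt (by exact_mod_cast hn)) hC.le)
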